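/- Let $n\ge 1$, let $m\ge 0$ be an integer, $\alpha>0$ and $0<q<p<\infty$. Write $D(z,r)=\{w\in\mathbb C^n:|w-z|<r\}$ and let $dV$ be Lebesgue measure on $\mathbb C^n$. For measurable $f$ put $\|f\|_p=\big((\tfrac{\alpha p}{2\pi})^n\int_{\mathbb C^n}|f(z)|^pe^{-\frac{\alpha p}{2}|z|^2}dV(z)\big)^{1/p}$. The Fock–Sobolev space $\mathcal F^p_{(m,\alpha)}$ is the set of entire functions $f$ on $\mathbb C^n$ with $\sum_{\beta_1+\dots+\beta_n\le m}\|\partial^\beta f\|_p<\infty$; on it we use the equivalent norm $$\|f\|_{(p,m)}=\Big(C_{(p,m,n)}\int_{\mathbb C^n}|z|^{mp}|f(z)|^pe^{-\frac{\alpha p}{2}|z|^2}dV(z)\Big)^{1/p},\qquad C_{(p,m,n)}=\Big(\frac{\alpha p}{2}\Big)^{\frac{mp}{2}+n}\frac{\Gamma(n)}{\pi^n\,\Gamma(\frac{mp}{2}+n)} .$$ Let $\mu$ be a nonnegative Borel measure on $\mathbb C^n$. It is a $(p,q)$ Fock–Carleson measure if there is a finite constant $C$ with $\int|f|^qe^{-\frac{\alpha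 q}{2}|z|^2}d\mu\le C\|f\|_{(p,m)}^q$ for all $f\in\mathcal F^p_{(m,\alpha)}$; let $\|\mu\|$ be the norm of the embedding $\mathcal F^p_{(m,\alpha)}\to L^q(e^{-\frac{\alpha q}{2}|z|^2}d\mu)$, that is, the least $C\in[0,\infty]$ with $\int|f|^qe^{-\frac{\alpha q}{2}|z|^2}d\mu\le C^q\|f\|_{(p,m)}^q$ for all such $f$. It is a vanishing $(p,q)$ Fock–Carleson measure if $\int|f_j|^qe^{-\frac{\alpha q}{2}|z|^2}d\mu\to0$ for every sequence $(f_j)$ in $\mathcal F^p_{(m,\alpha)}$ with $\sup_j\|f_j\|_{(p,m)}<\infty$ that converges to $0$ uniformly on compact sets. For $s\ge0$ and $t,r>0$ put $$\widetilde\mu_{(t,s)}(w)=\int_{\mathbb C^n}(1+|z|)^{-s}e^{-\frac{t\alpha}{2}|z-w|^2}d\mu(z),\qquad \mu_{(s,r,D)}(z)=\frac{\mu(D(z,r))}{(1+|z|)^s}.$$ An $r/2$-lattice is a sequence $(z_k)_{k\in\mathbb N}$ of distinct points of $\mathbb C^n$ such that the balls $D(z_k,r)$ cover $\mathbb C^n$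 and the balls $D(z_k,r/2)$ are mutually disjoint. Theorem. For every nonnegative Borel measure $\mu$ on $\mathbb C^n$ the following statements are equivalent: 1. $\mu$ is a $(p,q)$ Fock–Carleson measure; 2. $\mu$ is a vanishing $(p,q)$ Fock–Carleson measure; 3. $\widetilde\mu_{(t,mq)}\in L^{p/(p-q)}(\mathbb C^n,dV)$ for some (equivalently, for every) $t>0$; 4. $\mu_{(mq,r,D)}\in L^{p/(p-q)}(\mathbb C^n,dV)$ for some (equivalently, for every) $r>0$; 5. $(\mu_{(mq,r,D)}(z_k))_k\in\ell^{p/(p-q)}$ for some $r>0$ and some $r/2$-lattice $(z_k)$ (equivalently, for every $r>0$ and every $r/2$-lattice $(z_k)$). Moreover, for all $t,r>0$ and every $r/2$-lattice $(z_k)$, $$\|\mu\|^q\simeq\|\mu_{(mq,r,D)}\|_{L^{p/(p-q)}}\simeq\|\widetilde\mu_{(t,mq)}\|_{L^{p/(p-q)}}\simeq\|(\mu_{(mq,r,D)}(z_k))_k\|_{\ell^{p/(p-q)}},$$ with constants that do not depend on $\mu$ (all four quantities are taken in $[0,\infty]$). -/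

import Mathlib

open MeasureTheory Filter Topology
open scoped ENNReal NNReal

namespace FockSobolev

/-- The space `ℂⁿ` with its Euclidean norm, its Borel sets and Lebesgue measure `volume`. -/
abbrev Cn (n : ℕ) : Type := EuclideanSpace ℂ (Fin n)

noncomputable section

/-- The complex partial derivative `∂_j f`. -/
def partialDeriv {n : ℕ} (j : Fin n) (f : Cn n → ℂ) : Cn n → ℂ :=
  fun z => fderiv ℂ f z (EuclideanSpace.single j 1)

/-- The mixed derivative `∂^β f = ∂_1^{β_1} ⋯ ∂_n^{β_n} f`. -/
def multiDeriv {n : ℕ} (β : Fin n → ℕ) (f : Cn n → ℂ) : Cn n → ℂ :=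
  (List.finRange n).foldr (fun j g => (partialDeriv j)^[β j] g) f

/-- The Fock norm `‖f‖_p`, `0 < p < ∞`, with
`‖f‖_p ^ p = (α p / 2π)^n ∫ |f(z)|^p e^{-α p |z|² / 2} dV(z)`, as an extended real number. -/
def fockNorm {n : ℕ} (α p : ℝ) (f : Cn n → ℂ) : ℝ≥0∞ :=
  (ENNReal.ofReal ((α * p / (2 * Real.pi)) ^ n) *
    ∫⁻ z : Cn n, ‖f z‖ₑ ^ p * ENNReal.ofReal (Real.exp (-(α * p / 2) * ‖z‖ ^ 2))) ^ (1 / p)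

/-- The finite set of multi-indices `β` with `β_1 + ⋯ + β_n ≤ m`. -/
def multiIndices (n m : ℕ) : Finset (Fin n → ℕ) :=
  (Fintype.piFinset fun _ : Fin n => Finset.range (m + 1)).filter fun β => ∑ i, β i ≤ m

/-- Membership in the Fock–Sobolev space `F^p_{(m,α)}`: `f` is entire and
`∑_{β_1 + ⋯ + β_n ≤ m} ‖∂^β f‖_p < ∞`. -/
def MemFockSobolev {n : ℕ} (m : ℕ) (α p : ℝ) (f : Cn n → ℂ) : Prop :=
  Differentiable ℂ f ∧ ∑ β ∈ multiIndices n m, fockNorm α p (multiDeriv β f) < ∞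

/-- The constant `C_{(p,m,n)}` that gives the function `1` the norm `1`. -/
def normConst (n m : ℕ) (α p : ℝ) : ℝ :=
  (α * p / 2) ^ ((m : ℝ) * p / 2 + n) * Real.Gamma n /
    (Real.pi ^ n * Real.Gamma ((m : ℝ) * p / 2 + n))

/-- The weighted form of the Fock–Sobolev norm,
`‖f‖_{(p,m)} = (C_{(p,m,n)} ∫ |z|^{mp} |f(z)|^p e^{-α p |z|² / 2} dV(z))^{1/p}`. -/
def fockSobolevNorm {n : ℕ} (m : ℕ) (α p : ℝ) (f : Cn n → ℂ) : ℝ≥0∞ :=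
  (ENNReal.ofReal (normConst n m α p) *
    ∫⁻ z : Cn n, ENNReal.ofReal (‖z‖ ^ ((m : ℝ) * p)) * ‖f z‖ₑ ^ p *
      ENNReal.ofReal (Real.exp (-(α * p / 2) * ‖z‖ ^ 2))) ^ (1 / p)

/-- `∫ |f(z)|^q e^{-α q |z|² / 2} dμ(z)`. -/
def carlesonIntegral {n : ℕ} (α q : ℝ) (μ : Measure (Cn n)) (f : Cn n → ℂ) : ℝ≥0∞ :=
  ∫⁻ z, ‖f z‖ₑ ^ q * ENNReal.ofReal (Real.exp (-(α * q / 2) * ‖z‖ ^ 2)) ∂μ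

/-- `μ` is a `(p, q)` Fock–Carleson measure for the Fock–Sobolev spaces of order `m`. -/
def IsFockCarleson {n : ℕ} (m : ℕ) (α p q : ℝ) (μ : Measure (Cn n)) : Prop :=
  ∃ C : ℝ≥0, ∀ f : Cn n → ℂ, MemFockSobolev m α p f →
    carlesonIntegral α q μ f ≤ C * fockSobolevNorm m α p f ^ q

/-- `μ` is a `(p, q)` vanishing Fock–Carleson measure. -/
def IsVanishingFockCarleson {n : ℕ} (m : ℕ) (α p q : ℝ) (μ : Measure (Cn n)) : Prop :=
  ∀ f : ℕ → Cn n → ℂ, (∀ j, MemFockSobolev m α p (f j)) →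
    (∃ M : ℝ≥0, ∀ j, fockSobolevNorm m α p (f j) ≤ M) →
    (∀ K : Set (Cn n), IsCompact K → TendstoUniformlyOn f (fun _ => 0) atTop K) →
    Tendsto (fun j => carlesonIntegral α q μ (f j)) atTop (𝓝 0)

/-- The norm `‖μ‖ = ‖I_μ‖` of the embedding `I_μ : F^p_{(m,α)} → L^q(e^{-α q |z|² / 2} dμ)`:
the least `C` with `∫ |f|^q e^{-α q |z|² / 2} dμ ≤ C^q ‖f‖_{(p,m)}^q` for all `f`
(equal to `∞` if there is no finite one). -/
def carlesonNorm {n : ℕ} (m : ℕ) (α p q : ℝ) (μ : Measure (Cn n)) : ℝ≥0∞ :=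
  sInf {C : ℝ≥0∞ | ∀ f : Cn n → ℂ, MemFockSobolev m α p f →
    carlesonIntegral α q μ f ≤ C ^ q * fockSobolevNorm m α p f ^ q}

/-- The `(t, s)`-Berezin type transform
`w ↦ ∫ (1 + |z|)^{-s} e^{-t α |z - w|² / 2} dμ(z)`, with values in `[0, ∞]`. -/
def berezin {n : ℕ} (α t s : ℝ) (μ : Measure (Cn n)) (w : Cn n) : ℝ≥0∞ :=
  ∫⁻ z, ENNReal.ofReal ((1 + ‖z‖) ^ (-s) * Real.exp (-(t * α / 2) * ‖z - w‖ ^ 2)) ∂μ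

/-- The weighted averaging function `z ↦ μ(D(z, r)) / (1 + |z|)^s`, with values in `[0, ∞]`. -/
def averaging {n : ℕ} (s r : ℝ) (μ : Measure (Cn n)) (z : Cn n) : ℝ≥0∞ :=
  μ (Metric.ball z r) / ENNReal.ofReal ((1 + ‖z‖) ^ s)

/-- `(z_k)` is an `r/2`-lattice: the points are distinct, the balls `D(z_k, r)` cover `ℂⁿ` and the
balls `D(z_k, r/2)` are mutually disjoint. -/
structure IsHalfLattice {n : ℕ} (r : ℝ) (z : ℕ → Cn n) : Prop where
  injective : Function.Injective z
  covers : ⋃ k, Metric.ball (z k) r = Set.univ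
  disjoint : Pairwise fun j k => Disjoint (Metric.ball (z j) (r / 2)) (Metric.ball (z k) (r / 2))

/-- The `ℓ^s` norm of a sequence in `[0, ∞]`, `0 < s < ∞`. -/
def seqNorm (s : ℝ) (a : ℕ → ℝ≥0∞) : ℝ≥0∞ := (∑' k, a k ^ s) ^ (1 / s)

/-- `x` and `y` agree up to the factor `C`. -/
def ComparableWith (C : ℝ≥0) (x y : ℝ≥0∞) : Prop := x ≤ C * y ∧ y ≤ C * x

end

end FockSobolev

/-! Put σ = p/(p - q), the exponent conjugate to p/q. The size conditions on μ are comparable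
because all of them record local masses seen through Gaussian decay. The averaging function is
pointwise dominated by the Berezin transform (`averaging_le_berezin`). The Berezin transform is
dominated by a Gaussian convolution of the averaging function, bounded on L^σ by Schur's test
(`exists_lintegral_berezin_le`). The averaging function is dominated by a Gaussian superposition of
its values on a lattice (`exists_lintegral_averaging_le`). Moving a point by a bounded distance
costs a constant in the polynomial weight and half of the Gaussian exponent.

Sufficiency: |f|^q e^{-αq|z|²/2} is bounded at z by a multiple of its mean over D(z, r)
(`volume_mul_gaussian_le`). Fubini turns dμ into μ(D(u, r)) dV(u), and Hölder with exponents p/q and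
σ gives `exists_carlesonIntegral_le`.

Necessity: the embedding is tested on signed sums of normalised kernels at lattice points. Their
norms are controlled by the ℓ^p norm of the coefficients whatever the signs, while the average over
signs of the q-th powers dominates every single term (`exists_sum_averaging_le`). Duality of ℓ^{p/q}
and ℓ^σ then yields the lattice condition (`seqNorm_le_of_sum_le`).

Since σ is finite, dominated convergence makes the embedding norm of the part of μ far from the
origin small, so boundedness already forces vanishing. The converse is a rescaling argument. Local
finiteness of μ is never assumed; it is deduced whenever one of the norms is finite. -/

namespace FockSobolev

/-! ### Submean inequality for |f|^q, all q > 0. -/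

variable {n : ℕ}

/-- Jensen's formula bounds log |h 0| by the circle average of log |h|; convexity of the exponential
then passes to the power q, with no restriction q ≥ 1. -/
theorem norm_rpow_le_circleAverage {h : ℂ → ℂ} (hh : Differentiable ℂ h) {q : ℝ} (hq : 0 < q) :
    ‖h 0‖ ^ q ≤ Real.circleAverage (fun z => ‖h z‖ ^ q) 0 1 := by
  by_cases h0 : h 0 = 0
  · rw [h0, norm_zero, Real.zero_rpow hq.ne']
    exact Real.circleAverage_nonneg_of_nonneg fun x _ => by positivity
  have han : AnalyticOnNhd ℂ h Set.univ := hh.differentiableOn.analyticOnNhd isOpen_univ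
  have hlog := (han.mono (Set.subset_univ (Metric.closedBall 0 |1|))).circleAverage_log_norm
    one_ne_zero h0
  have hsum : 0 ≤ ∑ᶠ u, (MeromorphicOn.divisor h (Metric.closedBall 0 |1|) u : ℝ) *
      Real.log (1 * ‖0 - u‖⁻¹) := by
    refine finsum_nonneg fun u => ?_
    by_cases hu : u ∈ Metric.closedBall (0 : ℂ) |1|
    · refine mul_nonneg ?_ ?_
      · exact_mod_cast (MeromorphicOn.AnalyticOnNhd.divisor_nonneg
          (han.mono (Set.subset_univ (Metric.closedBall 0 |1|)))) u
      · by_cases hu0 : u = 0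
        -- The term at the origin is zero by the conventions `0⁻¹ = 0` and `Real.log 0 = 0`.
        · simp [hu0]
        · refine Real.log_nonneg ?_
          rw [one_mul, zero_sub, norm_neg]
          refine (one_le_inv₀ (by positivity)).2 ?_
          simpa using hu
    · rw [Function.locallyFinsuppWithin.apply_eq_zero_of_notMem _ hu]
      simp
  have hle : Real.log ‖h 0‖ ≤ Real.circleAverage (Real.log ‖h ·‖) 0 1 := by
    rw [hlog]; linarith
  have hint : CircleIntegrable (Real.log ‖h ·‖) 0 1 :=
    MeromorphicOn.circleIntegrable_log_norm fun z _ => (han z trivial).meromorphicAt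
  -- At a zero of h the right side is 1, since `Real.log 0 = 0`; equality therefore holds only off a
  -- discrete set, which circle averages ignore.
  have hcod : (fun z => ‖h z‖ ^ q) =ᶠ[codiscreteWithin (Metric.sphere (0 : ℂ) |1|)]
      fun z => Real.exp (q * Real.log ‖h z‖) := by
    have := han.preimage_zero_mem_codiscrete (x := 0) h0
    have := codiscreteWithin_mono (Set.subset_univ (Metric.sphere (0 : ℂ) |1|)) this
    filter_upwards [this] with z hz
    have hz : h z ≠ 0 := by simpa using hz
    rw [Real.rpow_def_of_pos (norm_pos_iff.2 hz), mul_comm]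
  have hint' : CircleIntegrable (fun z => ‖h z‖ ^ q) 0 1 := by
    refine ContinuousOn.circleIntegrable' ?_
    exact (hh.continuous.norm.rpow_const fun _ => Or.inr hq.le).continuousOn
  rw [Real.circleAverage_congr_codiscreteWithin hcod one_ne_zero]
  have hint'' : CircleIntegrable (fun z => Real.exp (q * Real.log ‖h z‖)) 0 1 :=
    hint'.congr_codiscreteWithin hcod
  set L := Real.log ‖h 0‖
  -- This is the tangent line of the exponential at q * L, evaluated at q log |h z|; it lies below
  -- the exponential.
  have hlow : CircleIntegrable (fun z => ‖h 0‖ ^ q * (1 - q * L) +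
      (‖h 0‖ ^ q * q) * Real.log ‖h z‖) 0 1 :=
    (circleIntegrable_const _ _ _).add (hint.const_fun_smul (a := ‖h 0‖ ^ q * q))
  refine le_trans ?_ (Real.circleAverage_mono hlow hint'' ?_)
  · have hadd := Real.circleAverage_fun_add (circleIntegrable_const (‖h 0‖ ^ q * (1 - q * L)) 0 1)
      (hint.const_fun_smul (a := ‖h 0‖ ^ q * q))
    simp only [smul_eq_mul] at hadd
    rw [hadd, Real.circleAverage_const]
    have := Real.circleAverage_fun_smul (a := ‖h 0‖ ^ q * q) (f := fun z => Real.log ‖h z‖)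
      (c := 0) (R := 1)
    simp only [smul_eq_mul] at this
    rw [this]
    have h2 : 0 ≤ ‖h 0‖ ^ q * q := by positivity
    nlinarith [mul_le_mul_of_nonneg_left hle h2]
  · intro z _
    have hexp : ‖h 0‖ ^ q = Real.exp (q * L) := by
      rw [Real.rpow_def_of_pos (norm_pos_iff.2 h0), mul_comm]
    have := Real.add_one_le_exp (q * Real.log ‖h z‖ - q * L)
    have h3 : Real.exp (q * Real.log ‖h z‖) =
        Real.exp (q * L) * Real.exp (q * Real.log ‖h z‖ - q * L) := by
      rw [← Real.exp_add]; ring_nf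
    rw [h3, hexp]
    nlinarith [mul_le_mul_of_nonneg_left this (Real.exp_pos (q * L)).le]

/-- The submean inequality on the unit circle, as a lower Lebesgue integral. -/
theorem enorm_rpow_le_lintegral_circle {h : ℂ → ℂ} (hh : Differentiable ℂ h) {q : ℝ}
    (hq : 0 < q) :
    ENNReal.ofReal (2 * Real.pi) * ‖h 0‖ₑ ^ q ≤
      ∫⁻ θ in Set.Ioc 0 (2 * Real.pi), ‖h (Complex.exp (θ * Complex.I))‖ₑ ^ q := by
  have key := norm_rpow_le_circleAverage hh hq
  have hcont : Continuous fun θ : ℝ => ‖h (Complex.exp (θ * Complex.I))‖ ^ q := by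
    refine Continuous.rpow_const ?_ fun _ => Or.inr hq.le
    exact (hh.continuous.comp (by fun_prop)).norm
  have h1 : ∀ x : ℂ, ‖x‖ₑ ^ q = ENNReal.ofReal (‖x‖ ^ q) := fun x => by
    rw [← ofReal_norm, ENNReal.ofReal_rpow_of_nonneg (norm_nonneg _) hq.le]
  simp only [h1]
  rw [← ofReal_integral_eq_lintegral_ofReal
    ((hcont.integrableOn_Icc (a := 0) (b := 2 * Real.pi)).mono_set Set.Ioc_subset_Icc_self)
    (ae_of_all _ fun θ => by positivity), ← ENNReal.ofReal_mul Real.two_pi_pos.le]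
  refine ENNReal.ofReal_le_ofReal ?_
  rw [Real.circleAverage_def, smul_eq_mul,
    intervalIntegral.integral_of_le Real.two_pi_pos.le] at key
  have := mul_le_mul_of_nonneg_left key Real.two_pi_pos.le
  rw [← mul_assoc, mul_inv_cancel₀ Real.two_pi_pos.ne', one_mul] at this
  simpa [circleMap] using this

/-- Multiplication by a unimodular complex number, as a real linear isometry of `ℂⁿ`. -/
noncomputable def rotation (θ : ℝ) : Cn n ≃ₗᵢ[ℝ] Cn n where
  toFun z := Complex.exp (θ * Complex.I) • z
  invFun z := Complex.exp (-(θ * Complex.I)) • z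
  map_add' := smul_add _
  map_smul' c x := smul_comm _ _ _
  left_inv z := by simp only [smul_smul, ← Complex.exp_add]; simp
  right_inv z := by simp only [smul_smul, ← Complex.exp_add]; simp
  norm_map' z := by
    change ‖Complex.exp (θ * Complex.I) • z‖ = ‖z‖
    rw [norm_smul, Complex.norm_exp_ofReal_mul_I, one_mul]

@[simp] theorem rotation_apply (θ : ℝ) (z : Cn n) :
    rotation θ z = Complex.exp (θ * Complex.I) • z := rfl

/-- The submean inequality over a rotation invariant set. -/
theorem volume_mul_enorm_rpow_le {f : Cn n → ℂ} (hf : Differentiable ℂ f) {q : ℝ} (hq : 0 < q)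
    {s : Set ℝ} (hs : MeasurableSet s) :
    volume {w : Cn n | ‖w‖ ∈ s} * ‖f 0‖ₑ ^ q ≤ ∫⁻ w in {w : Cn n | ‖w‖ ∈ s}, ‖f w‖ₑ ^ q := by
  set A := {w : Cn n | ‖w‖ ∈ s}
  have hA : MeasurableSet A := measurable_norm hs
  have hmeas : Measurable fun w : Cn n => ‖f w‖ₑ ^ q :=
    (hf.continuous.measurable.enorm).pow_const q
  have hrot : ∀ θ : ℝ, ∫⁻ w in A, ‖f (Complex.exp (θ * Complex.I) • w)‖ₑ ^ q =
      ∫⁻ w in A, ‖f w‖ₑ ^ q := by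
    intro θ
    have hm := (rotation (n := n) θ).measurePreserving
    have hpre : (rotation (n := n) θ) ⁻¹' A = A := by
      ext w; simp only [A, Set.mem_preimage, Set.mem_ofPred_eq, LinearIsometryEquiv.norm_map]
    have := hm.setLIntegral_comp_preimage hA hmeas
    rw [hpre] at this
    simpa using this
  have hpi : ENNReal.ofReal (2 * Real.pi) ≠ 0 := by
    simp [Real.pi_pos]
  rw [← ENNReal.mul_le_mul_iff_right hpi ENNReal.ofReal_ne_top]
  -- The circle inequality is applied to each slice ζ ↦ f (ζ w) and integrated over w in A. After
  -- Tonelli every rotation contributes the same integral, as it preserves both A and volume.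
  calc ENNReal.ofReal (2 * Real.pi) * (volume A * ‖f 0‖ₑ ^ q)
      = ∫⁻ w in A, ENNReal.ofReal (2 * Real.pi) * ‖f 0‖ₑ ^ q := by
        rw [setLIntegral_const]; ring
    _ ≤ ∫⁻ w in A, ∫⁻ θ in Set.Ioc 0 (2 * Real.pi),
          ‖f (Complex.exp (θ * Complex.I) • w)‖ₑ ^ q := by
        refine lintegral_mono fun w => ?_
        have := enorm_rpow_le_lintegral_circle (h := fun ζ : ℂ => f (ζ • w))
          (hf.comp (by fun_prop)) hq
        simpa using this
    _ = ∫⁻ θ in Set.Ioc 0 (2 * Real.pi), ∫⁻ w in A,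
          ‖f (Complex.exp (θ * Complex.I) • w)‖ₑ ^ q := by
        refine lintegral_lintegral_swap ?_
        refine Measurable.aemeasurable (Measurable.pow_const ?_ q)
        refine (hf.continuous.comp ?_).measurable.enorm
        fun_prop
    _ = ENNReal.ofReal (2 * Real.pi) * ∫⁻ w in A, ‖f w‖ₑ ^ q := by
        simp only [hrot]
        rw [setLIntegral_const, Real.volume_Ioc, sub_zero, mul_comm]

/-! ### Gaussian weights: absorbing polynomial factors and shifting centres. -/

/-- The Gaussian weight `e^{-b |z|²}` as an extended nonnegative real. -/
noncomputable def gaussian (b : ℝ) (z : Cn n) : ℝ≥0∞ :=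
  ENNReal.ofReal (Real.exp (-b * ‖z‖ ^ 2))

theorem continuous_gaussian (b : ℝ) : Continuous (gaussian b : Cn n → ℝ≥0∞) :=
  ENNReal.continuous_ofReal.comp (by fun_prop)

@[fun_prop]
theorem measurable_gaussian (b : ℝ) : Measurable (gaussian b : Cn n → ℝ≥0∞) :=
  (continuous_gaussian b).measurable

theorem gaussian_sub_comm (b : ℝ) (z w : Cn n) : gaussian b (z - w) = gaussian b (w - z) := by
  simp [gaussian, norm_sub_rev]

theorem gaussian_rpow (b : ℝ) (z : Cn n) (p : ℝ) : gaussian b z ^ p = gaussian (b * p) z := by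
  rw [gaussian, ENNReal.ofReal_rpow_of_pos (Real.exp_pos _), ← Real.exp_mul, gaussian]
  ring_nf

/-- Combine 1 + x ≤ e^x with ax ≤ a²/(4b) + bx². Polynomial weights can thus be absorbed by any
Gaussian. -/
theorem one_add_rpow_le_exp {a b x : ℝ} (ha : 0 ≤ a) (hb : 0 < b) (hx : 0 ≤ x) :
    (1 + x) ^ a ≤ Real.exp (a ^ 2 / (4 * b)) * Real.exp (b * x ^ 2) := by
  have h1 : (1 + x) ^ a ≤ Real.exp x ^ a :=
    Real.rpow_le_rpow (by positivity) (by linarith [Real.add_one_le_exp x]) ha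
  refine h1.trans ?_
  rw [← Real.exp_mul, ← Real.exp_add]
  refine Real.exp_le_exp.2 ?_
  have h2 : a ^ 2 / (4 * b) + b * x ^ 2 - x * a = (a - 2 * b * x) ^ 2 / (4 * b) := by
    field_simp
    ring
  have h3 : 0 ≤ (a - 2 * b * x) ^ 2 / (4 * b) := by positivity
  linarith

theorem one_add_norm_rpow_le {a : ℝ} (ha : 0 ≤ a) (z w : Cn n) :
    (1 + ‖z‖) ^ a ≤ (1 + ‖w‖) ^ a * (1 + ‖z - w‖) ^ a := by
  rw [← Real.mul_rpow (by positivity) (by positivity)]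
  refine Real.rpow_le_rpow (by positivity) ?_ ha
  have : ‖z‖ ≤ ‖w‖ + ‖z - w‖ := norm_le_norm_add_norm_sub' z w
  nlinarith [norm_nonneg w, norm_nonneg (z - w), mul_nonneg (norm_nonneg w) (norm_nonneg (z - w))]

/-- The weight moves from z to w at the price of (1 + |z - w|)^a, which half of the Gaussian
exponent pays for. -/
theorem weight_mul_exp_le {a b : ℝ} (ha : 0 ≤ a) (hb : 0 < b) (z w : Cn n) :
    (1 + ‖z‖) ^ a * Real.exp (-b * ‖z - w‖ ^ 2) ≤
      Real.exp (a ^ 2 / (2 * b)) * (1 + ‖w‖) ^ a * Real.exp (-(b / 2) * ‖z - w‖ ^ 2) := by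
  have h1 := one_add_norm_rpow_le ha z w
  have h2 := one_add_rpow_le_exp ha (half_pos hb) (norm_nonneg (z - w))
  have h3 : Real.exp (-(b / 2) * ‖z - w‖ ^ 2) =
      Real.exp (b / 2 * ‖z - w‖ ^ 2) * Real.exp (-b * ‖z - w‖ ^ 2) := by
    rw [← Real.exp_add]; ring_nf
  rw [h3]
  have h4 : (4 * (b / 2)) = 2 * b := by ring
  rw [h4] at h2
  calc (1 + ‖z‖) ^ a * Real.exp (-b * ‖z - w‖ ^ 2)
      ≤ (1 + ‖w‖) ^ a * (Real.exp (a ^ 2 / (2 * b)) * Real.exp (b / 2 * ‖z - w‖ ^ 2)) *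
        Real.exp (-b * ‖z - w‖ ^ 2) := by
        gcongr
        exact h1.trans (by gcongr)
    _ = _ := by ring

/-- From |u - y|² ≤ 2ρ² + 2|x - y|²: a bounded displacement of the centre costs a constant and half
of the exponent. -/
theorem exp_neg_sq_le_of_dist_le {b ρ : ℝ} (hb : 0 ≤ b) {x u : Cn n} (h : ‖x - u‖ ≤ ρ)
    (y : Cn n) :
    Real.exp (-b * ‖x - y‖ ^ 2) ≤ Real.exp (b * ρ ^ 2) * Real.exp (-(b / 2) * ‖u - y‖ ^ 2) := by
  rw [← Real.exp_add]
  refine Real.exp_le_exp.2 ?_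
  have h1 : ‖u - y‖ ≤ ‖x - u‖ + ‖x - y‖ := by
    have := norm_sub_le_norm_sub_add_norm_sub u x y
    rwa [norm_sub_rev u x] at this
  have h2 : ‖u - y‖ ^ 2 ≤ 2 * ρ ^ 2 + 2 * ‖x - y‖ ^ 2 := by
    have h3 : ‖u - y‖ ^ 2 ≤ (ρ + ‖x - y‖) ^ 2 :=
      pow_le_pow_left₀ (norm_nonneg _) (h1.trans (by linarith)) 2
    nlinarith [sq_nonneg (ρ - ‖x - y‖)]
  nlinarith [mul_le_mul_of_nonneg_left h2 hb]

theorem gaussian_le_of_dist_le {b ρ : ℝ} (hb : 0 ≤ b) {x u : Cn n} (h : ‖x - u‖ ≤ ρ)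
    (y : Cn n) :
    gaussian b (x - y) ≤ ENNReal.ofReal (Real.exp (b * ρ ^ 2)) * gaussian (b / 2) (u - y) := by
  rw [gaussian, gaussian, ← ENNReal.ofReal_mul (Real.exp_pos _).le]
  exact ENNReal.ofReal_le_ofReal (exp_neg_sq_le_of_dist_le hb h y)

theorem lintegral_gaussian_lt_top {b : ℝ} (hb : 0 < b) :
    ∫⁻ z : Cn n, gaussian b z < ∞ := by
  -- Any decay exponent above the real dimension makes (1 + |z|)^{-d} integrable.
  set d : ℝ := Module.finrank ℝ (Cn n) + 1
  have hd : 0 ≤ d := by positivity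
  have hint : Integrable fun z : Cn n => (1 + ‖z‖) ^ (-d) :=
    integrable_one_add_norm (by simp [d])
  refine lt_of_le_of_lt (lintegral_mono fun z => ?_)
    ((hint.const_mul (Real.exp (d ^ 2 / (4 * b)))).lintegral_lt_top)
  refine ENNReal.ofReal_le_ofReal ?_
  have h := one_add_rpow_le_exp hd hb (norm_nonneg z)
  have hpos : 0 < (1 + ‖z‖) ^ d := by positivity
  rw [Real.rpow_neg (by positivity), neg_mul, Real.exp_neg]
  rw [← div_eq_mul_inv, le_div_iff₀ hpos, inv_mul_le_iff₀ (Real.exp_pos _)]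
  linarith

theorem lintegral_gaussian_sub_right (b : ℝ) (w : Cn n) :
    ∫⁻ z : Cn n, gaussian b (z - w) = ∫⁻ z : Cn n, gaussian b z :=
  lintegral_sub_right_eq_self _ w

theorem lintegral_gaussian_sub_left (b : ℝ) (w : Cn n) :
    ∫⁻ z : Cn n, gaussian b (w - z) = ∫⁻ z : Cn n, gaussian b z := by
  simp_rw [gaussian_sub_comm b w]
  exact lintegral_gaussian_sub_right b w

/-- Gaussian sums over a separated sequence are uniformly bounded. -/
theorem exists_tsum_gaussian_le {b ρ : ℝ} (hb : 0 < b) (hρ : 0 < ρ) :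
    ∃ M : ℝ≥0∞, M ≠ ∞ ∧ ∀ z : ℕ → Cn n,
      (Pairwise fun j k => Disjoint (Metric.ball (z j) ρ) (Metric.ball (z k) ρ)) →
      ∀ w, ∑' k, gaussian b (z k - w) ≤ M := by
  set v := volume (Metric.ball (0 : Cn n) ρ)
  have hv : v ≠ 0 := (Metric.measure_ball_pos volume _ hρ).ne'
  have hv' : v ≠ ∞ := measure_ball_lt_top.ne
  set E := ENNReal.ofReal (Real.exp (b * ρ ^ 2))
  refine ⟨v⁻¹ * (E * ∫⁻ u : Cn n, gaussian (b / 2) u), ?_, fun z hz w => ?_⟩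
  · exact ENNReal.mul_ne_top (ENNReal.inv_ne_top.2 hv)
      (ENNReal.mul_ne_top ENNReal.ofReal_ne_top (lintegral_gaussian_lt_top (half_pos hb)).ne)
  -- Each term is compared with the integral of a wider Gaussian over its own ball; as the balls are
  -- disjoint, the sum is at most one full Gaussian integral.
  have key : ∀ k, v * gaussian b (z k - w) ≤
      E * ∫⁻ u in Metric.ball (z k) ρ, gaussian (b / 2) (u - w) := by
    intro k
    calc v * gaussian b (z k - w)
        = ∫⁻ u in Metric.ball (z k) ρ, gaussian b (z k - w) := by
          rw [setLIntegral_const, mul_comm, Measure.addHaar_ball_center]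
      _ ≤ ∫⁻ u in Metric.ball (z k) ρ, E * gaussian (b / 2) (u - w) := by
          refine setLIntegral_mono' Metric.isOpen_ball.measurableSet fun u hu => ?_
          refine gaussian_le_of_dist_le hb.le ?_ w
          rw [← dist_eq_norm, dist_comm]
          exact (Metric.mem_ball.1 hu).le
      _ = _ := lintegral_const_mul' _ _ ENNReal.ofReal_ne_top
  rw [← ENNReal.mul_le_iff_le_inv hv hv', ← ENNReal.tsum_mul_left]
  calc ∑' k, v * gaussian b (z k - w)
      ≤ ∑' k, E * ∫⁻ u in Metric.ball (z k) ρ, gaussian (b / 2) (u - w) :=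
        ENNReal.tsum_le_tsum key
    _ = E * ∫⁻ u in ⋃ k, Metric.ball (z k) ρ, gaussian (b / 2) (u - w) := by
        rw [ENNReal.tsum_mul_left, lintegral_iUnion (fun k => Metric.isOpen_ball.measurableSet) hz]
    _ ≤ E * ∫⁻ u : Cn n, gaussian (b / 2) u := by
        refine mul_le_mul_right ((setLIntegral_le_lintegral _ _).trans_eq ?_) _
        exact lintegral_gaussian_sub_right _ w

/-! ### Schur's test and Gaussian superpositions. -/

/-- Jensen's inequality for a kernel, in the form given by Hölder's inequality. -/
theorem lintegral_mul_rpow_le {X : Type*} [MeasurableSpace X] {ν : Measure X} {K f : X → ℝ≥0∞}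
    (hK : Measurable K) (hf : Measurable f) {σ : ℝ} (hσ : 1 < σ) :
    (∫⁻ x, K x * f x ∂ν) ^ σ ≤ (∫⁻ x, K x ∂ν) ^ (σ - 1) * ∫⁻ x, K x * f x ^ σ ∂ν := by
  have hconj := (Real.HolderConjugate.conjExponent hσ)
  set τ := σ.conjExponent
  have hσ0 : 0 < σ := by linarith
  -- Hölder for f against the constant 1, with respect to the measure K dν.
  have h := ENNReal.lintegral_mul_le_Lp_mul_Lq (ν.withDensity K) hconj hf.aemeasurable
    (g := fun _ => 1) aemeasurable_const
  simp only [Pi.mul_apply, mul_one, ENNReal.one_rpow] at h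
  rw [lintegral_withDensity_eq_lintegral_mul _ hK hf,
    lintegral_withDensity_eq_lintegral_mul _ hK (hf.pow_const σ),
    lintegral_withDensity_eq_lintegral_mul _ hK measurable_const] at h
  simp only [Pi.mul_apply, mul_one] at h
  have h2 := ENNReal.rpow_le_rpow h hσ0.le
  rw [ENNReal.mul_rpow_of_nonneg _ _ hσ0.le, ← ENNReal.rpow_mul, ← ENNReal.rpow_mul,
    one_div_mul_cancel hσ0.ne', ENNReal.rpow_one] at h2
  have h3 : 1 / τ * σ = σ - 1 := by
    have := hconj.sub_one_mul_conj
    have hτ : τ ≠ 0 := hconj.symm.pos.ne'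
    field_simp
    linarith
  rw [h3, mul_comm] at h2
  exact h2

/-- Schur's test for a nonnegative kernel. -/
theorem lintegral_lintegral_mul_rpow_le {X Y : Type*} [MeasurableSpace X] [MeasurableSpace Y]
    {ν : Measure X} {τ : Measure Y} [SFinite ν] [SFinite τ] {K : X → Y → ℝ≥0∞}
    (hK : Measurable (Function.uncurry K)) {f : X → ℝ≥0∞} (hf : Measurable f) {σ : ℝ}
    (hσ : 1 < σ) {M M' : ℝ≥0∞} (h1 : ∀ y, ∫⁻ x, K x y ∂ν ≤ M) (h2 : ∀ x, ∫⁻ y, K x y ∂τ ≤ M') :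
    ∫⁻ y, (∫⁻ x, K x y * f x ∂ν) ^ σ ∂τ ≤ M ^ (σ - 1) * M' * ∫⁻ x, f x ^ σ ∂ν := by
  have hsec : ∀ y, Measurable fun x => K x y := fun y => hK.comp measurable_prodMk_right
  have hsec' : ∀ x, Measurable fun y => K x y := fun x => hK.comp measurable_prodMk_left
  have hKf : Measurable (Function.uncurry fun y x => K x y * f x ^ σ) :=
    (hK.comp measurable_swap).mul ((hf.pow_const σ).comp measurable_snd)
  calc ∫⁻ y, (∫⁻ x, K x y * f x ∂ν) ^ σ ∂τ
      ≤ ∫⁻ y, M ^ (σ - 1) * ∫⁻ x, K x y * f x ^ σ ∂ν ∂τ := by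
        refine lintegral_mono fun y => (lintegral_mul_rpow_le (hsec y) hf hσ).trans ?_
        gcongr
        exact h1 y
    _ = M ^ (σ - 1) * ∫⁻ y, ∫⁻ x, K x y * f x ^ σ ∂ν ∂τ :=
        lintegral_const_mul _ hKf.lintegral_prod_right'
    _ = M ^ (σ - 1) * ∫⁻ x, ∫⁻ y, K x y * f x ^ σ ∂τ ∂ν := by
        rw [lintegral_lintegral_swap hKf.aemeasurable]
    _ ≤ M ^ (σ - 1) * ∫⁻ x, M' * f x ^ σ ∂ν := by
        gcongr with x
        rw [lintegral_mul_const _ (hsec' x)]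
        gcongr
        exact h2 x
    _ = _ := by
        rw [lintegral_const_mul _ (hf.pow_const σ), mul_assoc]

theorem tsum_rpow_le {p : ℝ} (hp : 0 < p) (hp1 : p ≤ 1) (a : ℕ → ℝ≥0∞) :
    (∑' k, a k) ^ p ≤ ∑' k, a k ^ p := by
  have h1 : ∀ s : Finset ℕ, (∑ k ∈ s, a k) ^ p ≤ ∑' k, a k ^ p := fun s => by
    refine le_trans ?_ (ENNReal.sum_le_tsum s)
    induction s using Finset.induction_on with
    | empty => simp [ENNReal.zero_rpow_of_pos hp]
    | insert i s hi ih =>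
      rw [Finset.sum_insert hi, Finset.sum_insert hi]
      exact (ENNReal.rpow_add_le_add_rpow _ _ hp.le hp1).trans (by gcongr)
  have h2 : ∑' k, a k ≤ (∑' k, a k ^ p) ^ p⁻¹ := by
    rw [ENNReal.tsum_eq_iSup_sum]
    exact iSup_le fun s => (ENNReal.le_rpow_inv_iff hp).2 (h1 s)
  exact (ENNReal.le_rpow_inv_iff hp).1 h2

/-- The `L^p` norm of a Gaussian superposition over a separated sequence is controlled by the
`ℓ^p` norm of the coefficients, for every `p > 0`. -/
theorem exists_lintegral_tsum_gaussian_rpow_le {b ρ p : ℝ} (hb : 0 < b) (hρ : 0 < ρ)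
    (hp : 0 < p) :
    ∃ M : ℝ≥0∞, M ≠ ∞ ∧ ∀ z : ℕ → Cn n,
      (Pairwise fun j k => Disjoint (Metric.ball (z j) ρ) (Metric.ball (z k) ρ)) →
      ∀ c : ℕ → ℝ≥0∞,
        ∫⁻ w, (∑' k, gaussian b (z k - w) * c k) ^ p ≤ M * ∑' k, c k ^ p := by
  -- For p ≤ 1 the p-th power is subadditive, so the terms integrate separately and no separation is
  -- needed. For p > 1 this is Schur's test between counting measure and volume, with row sums
  -- bounded by separation.
  rcases le_or_gt p 1 with hp1 | hp1
  · refine ⟨∫⁻ w : Cn n, gaussian (b * p) w, (lintegral_gaussian_lt_top (mul_pos hb hp)).ne,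
      fun z _ c => ?_⟩
    calc ∫⁻ w, (∑' k, gaussian b (z k - w) * c k) ^ p
        ≤ ∫⁻ w, ∑' k, gaussian (b * p) (z k - w) * c k ^ p := by
          refine lintegral_mono fun w => (tsum_rpow_le hp hp1 _).trans_eq ?_
          simp_rw [ENNReal.mul_rpow_of_nonneg _ _ hp.le, gaussian_rpow]
      _ = ∑' k, ∫⁻ w, gaussian (b * p) (z k - w) * c k ^ p :=
          lintegral_tsum fun k => by fun_prop
      _ = _ := by
          rw [← ENNReal.tsum_mul_left]
          refine tsum_congr fun k => ?_
          rw [lintegral_mul_const _ (by fun_prop), lintegral_gaussian_sub_left]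
  · obtain ⟨M, hM, h⟩ := exists_tsum_gaussian_le (n := n) hb hρ
    refine ⟨M ^ (p - 1) * ∫⁻ w : Cn n, gaussian b w,
      ENNReal.mul_ne_top (ENNReal.rpow_ne_top_of_nonneg (by linarith) hM)
        (lintegral_gaussian_lt_top hb).ne, fun z hz c => ?_⟩
    have := lintegral_lintegral_mul_rpow_le (ν := Measure.count) (τ := (volume : Measure (Cn n)))
      (K := fun k w => gaussian b (z k - w)) (f := c) ?_ (measurable_of_countable c) hp1 (M := M)
      (M' := ∫⁻ w : Cn n, gaussian b w) ?_ ?_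
    · simpa only [lintegral_count] using this
    · refine measurable_from_prod_countable_right fun k => ?_
      exact (measurable_gaussian b).comp (by fun_prop)
    · intro w
      rw [lintegral_count]
      exact h z hz w
    · intro k
      rw [lintegral_gaussian_sub_left]

/-! ### Submean inequality with Gaussian weight. -/

/-- Expanding |z + w|² shows that a factor holomorphic in w carries the Gaussian from z to z + w, up
to e^{αq|w|²/2}; the latter is bounded on bounded sets of w. -/
theorem gaussian_mul_enorm_exp_rpow (α q : ℝ) (z w : Cn n) (hq : 0 ≤ q) :
    gaussian (α * q / 2) z * ‖Complex.exp (-α * inner ℂ z w)‖ₑ ^ q =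
      gaussian (α * q / 2) (z + w) * ENNReal.ofReal (Real.exp (α * q / 2 * ‖w‖ ^ 2)) := by
  rw [← ofReal_norm, Complex.norm_exp, ENNReal.ofReal_rpow_of_nonneg (Real.exp_pos _).le hq,
    gaussian, gaussian, ← ENNReal.ofReal_mul (Real.exp_pos _).le,
    ← ENNReal.ofReal_mul (Real.exp_pos _).le, ← Real.exp_mul, ← Real.exp_add, ← Real.exp_add,
    @norm_add_sq ℂ _ _ _ _ z w]
  congr 2
  have : (-(α : ℂ) * inner ℂ z w).re = -α * (inner ℂ z w : ℂ).re := by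
    simp [Complex.mul_re]
  rw [this]
  simp only [RCLike.re_to_complex]
  ring

/-- The Gaussian weighted submean inequality over `{w | |w - z| ∈ s}`. -/
theorem volume_mul_gaussian_le {f : Cn n → ℂ} (hf : Differentiable ℂ f) {α q R : ℝ}
    (hα : 0 < α) (hq : 0 < q) {s : Set ℝ} (hs : MeasurableSet s) (hsR : ∀ x ∈ s, |x| ≤ R)
    (z : Cn n) :
    volume {w : Cn n | ‖w‖ ∈ s} * (‖f z‖ₑ ^ q * gaussian (α * q / 2) z) ≤
      ENNReal.ofReal (Real.exp (α * q / 2 * R ^ 2)) *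
        ∫⁻ w in {w : Cn n | ‖w - z‖ ∈ s}, ‖f w‖ₑ ^ q * gaussian (α * q / 2) w := by
  set A := {w : Cn n | ‖w‖ ∈ s}
  have hA : MeasurableSet A := measurable_norm hs
  -- The inner product is linear in its second argument, so h is entire, and h 0 = f z. The
  -- unweighted inequality is applied to h.
  set h : Cn n → ℂ := fun w => f (z + w) * Complex.exp (-α * inner ℂ z w)
  have hh : Differentiable ℂ h := by
    refine (hf.comp (by fun_prop)).mul (Complex.differentiable_exp.comp ?_)
    exact (differentiable_const _).mul (innerSL ℂ z).differentiable
  have hmeas : Measurable fun w : Cn n => ‖f w‖ₑ ^ q * gaussian (α * q / 2) w :=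
    ((hf.continuous.measurable.enorm).pow_const q).mul (measurable_gaussian _)
  have hshift : ∫⁻ w in A, ‖f (z + w)‖ₑ ^ q * gaussian (α * q / 2) (z + w) =
      ∫⁻ w in {w : Cn n | ‖w - z‖ ∈ s}, ‖f w‖ₑ ^ q * gaussian (α * q / 2) w := by
    have hB : MeasurableSet {w : Cn n | ‖w - z‖ ∈ s} :=
      (measurable_norm.comp (measurable_id.sub_const z)) hs
    have := (measurePreserving_add_left (volume : Measure (Cn n)) z).setLIntegral_comp_preimage
      hB hmeas
    rw [← this]
    congr 2
    ext w
    simp [A]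
  calc volume A * (‖f z‖ₑ ^ q * gaussian (α * q / 2) z)
      = volume A * ‖h 0‖ₑ ^ q * gaussian (α * q / 2) z := by simp [h, mul_assoc]
    _ ≤ (∫⁻ w in A, ‖h w‖ₑ ^ q) * gaussian (α * q / 2) z := by
        gcongr
        exact volume_mul_enorm_rpow_le hh hq hs
    _ = ∫⁻ w in A, ‖h w‖ₑ ^ q * gaussian (α * q / 2) z :=
        (lintegral_mul_const _ (hh.continuous.measurable.enorm.pow_const q)).symm
    _ ≤ ∫⁻ w in A, ENNReal.ofReal (Real.exp (α * q / 2 * R ^ 2)) *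
          (‖f (z + w)‖ₑ ^ q * gaussian (α * q / 2) (z + w)) := by
        refine setLIntegral_mono' hA fun w hw => ?_
        rw [enorm_mul, ENNReal.mul_rpow_of_nonneg _ _ hq.le, mul_assoc,
          mul_comm _ (gaussian _ z), gaussian_mul_enorm_exp_rpow _ _ _ _ hq.le,
          ← mul_assoc, mul_comm]
        gcongr
        have := hsR _ hw
        rwa [abs_norm] at this
    _ = _ := by
        rw [lintegral_const_mul' _ _ ENNReal.ofReal_ne_top, hshift]

theorem volume_ball_mul_gaussian_le {f : Cn n → ℂ} (hf : Differentiable ℂ f) {α q r : ℝ}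
    (hα : 0 < α) (hq : 0 < q) (z : Cn n) :
    volume (Metric.ball (0 : Cn n) r) * (‖f z‖ₑ ^ q * gaussian (α * q / 2) z) ≤
      ENNReal.ofReal (Real.exp (α * q / 2 * r ^ 2)) *
        ∫⁻ w in Metric.ball z r, ‖f w‖ₑ ^ q * gaussian (α * q / 2) w := by
  have := volume_mul_gaussian_le hf hα hq (s := Set.Ico 0 r) measurableSet_Ico
    (R := r) (fun x hx => by rw [abs_of_nonneg hx.1]; exact hx.2.le) z
  have h1 : ∀ y : Cn n, {w : Cn n | ‖w - y‖ ∈ Set.Ico 0 r} = Metric.ball y r := fun y => by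
    ext w; simp [dist_eq_norm]
  rw [h1] at this
  have h2 := h1 0
  simp only [sub_zero] at h2
  rwa [h2] at this

/-! ### The averaging function -/

/-- D(z, r) is exhausted by the balls D(z, r - 1/(k+1)), and D(w, r) contains the k-th of them when
w is within 1/(k+1) of z. This gives measurability of the averaging function for every μ, with no
finiteness assumption. -/
theorem lowerSemicontinuous_measure_ball (μ : Measure (Cn n)) (r : ℝ) :
    LowerSemicontinuous fun z => μ (Metric.ball z r) := by
  intro z y hy
  have hmono : Monotone fun k : ℕ => Metric.ball z (r - 1 / ((k : ℝ) + 1)) := fun i j hij => by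
    refine Metric.ball_subset_ball ?_
    have := Nat.one_div_le_one_div (α := ℝ) hij
    linarith
  have hU : ⋃ k : ℕ, Metric.ball z (r - 1 / ((k : ℝ) + 1)) = Metric.ball z r := by
    ext w
    simp only [Set.mem_iUnion, Metric.mem_ball]
    constructor
    · rintro ⟨k, hk⟩
      have : 0 < 1 / ((k : ℝ) + 1) := by positivity
      linarith
    · intro hw
      obtain ⟨k, hk⟩ := exists_nat_one_div_lt (sub_pos.2 hw)
      exact ⟨k, by linarith⟩
  change y < μ (Metric.ball z r) at hy
  rw [← hU, hmono.measure_iUnion] at hy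
  obtain ⟨k, hk⟩ := lt_iSup_iff.1 hy
  have hpos : 0 < 1 / ((k : ℝ) + 1) := by positivity
  filter_upwards [Metric.ball_mem_nhds z hpos] with w hw
  refine hk.trans_le (measure_mono (Metric.ball_subset_ball' ?_))
  rw [dist_comm]
  have := Metric.mem_ball.1 hw
  linarith

theorem measurable_averaging (s r : ℝ) (μ : Measure (Cn n)) : Measurable (averaging s r μ) := by
  refine (lowerSemicontinuous_measure_ball μ r).measurable.div ?_
  refine ENNReal.measurable_ofReal.comp ?_
  fun_prop

theorem ofReal_weight_ne_zero (s : ℝ) (z : Cn n) : ENNReal.ofReal ((1 + ‖z‖) ^ s) ≠ 0 := by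
  have : 0 < (1 + ‖z‖) ^ s := by positivity
  simpa using this

theorem ofReal_weight_mul_neg (s : ℝ) (z : Cn n) :
    ENNReal.ofReal ((1 + ‖z‖) ^ s) * ENNReal.ofReal ((1 + ‖z‖) ^ (-s)) = 1 := by
  rw [← ENNReal.ofReal_mul (by positivity), ← Real.rpow_add (by positivity)]
  simp

theorem ofReal_weight_neg (s : ℝ) (z : Cn n) :
    ENNReal.ofReal ((1 + ‖z‖) ^ (-s)) = (ENNReal.ofReal ((1 + ‖z‖) ^ s))⁻¹ := by
  rw [Real.rpow_neg (by positivity), ENNReal.ofReal_inv_of_pos (by positivity)]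

theorem averaging_eq (s r : ℝ) (μ : Measure (Cn n)) (z : Cn n) :
    averaging s r μ z = ENNReal.ofReal ((1 + ‖z‖) ^ (-s)) * μ (Metric.ball z r) := by
  rw [averaging, ENNReal.div_eq_inv_mul, ofReal_weight_neg]

theorem weight_neg_le {s ρ : ℝ} (hs : 0 ≤ s) {z w : Cn n} (h : ‖z - w‖ ≤ ρ) :
    (1 + ‖z‖) ^ (-s) ≤ (1 + ρ) ^ s * (1 + ‖w‖) ^ (-s) := by
  have h1 := one_add_norm_rpow_le hs w z
  rw [norm_sub_rev] at h1
  have h2 : (1 + ‖z - w‖) ^ s ≤ (1 + ρ) ^ s := by gcongr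
  have h3 : 0 < (1 + ‖z‖) ^ s := by positivity
  have h4 : 0 < (1 + ‖w‖) ^ s := by positivity
  rw [Real.rpow_neg (by positivity), Real.rpow_neg (by positivity), ← div_eq_mul_inv,
    le_div_iff₀ h4, inv_mul_le_iff₀ h3]
  exact h1.trans (by gcongr)

theorem ofReal_weight_neg_le {s ρ : ℝ} (hs : 0 ≤ s) {z w : Cn n} (h : ‖z - w‖ ≤ ρ) :
    ENNReal.ofReal ((1 + ‖z‖) ^ (-s)) ≤
      ENNReal.ofReal ((1 + ρ) ^ s) * ENNReal.ofReal ((1 + ‖w‖) ^ (-s)) := by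
  have : 0 ≤ ρ := (norm_nonneg _).trans h
  rw [← ENNReal.ofReal_mul (by positivity)]
  exact ENNReal.ofReal_le_ofReal (weight_neg_le hs h)

theorem berezin_eq (α t s : ℝ) (μ : Measure (Cn n)) (w : Cn n) :
    berezin α t s μ w =
      ∫⁻ z, ENNReal.ofReal ((1 + ‖z‖) ^ (-s)) * gaussian (t * α / 2) (z - w) ∂μ := by
  refine lintegral_congr fun z => ?_
  rw [ENNReal.ofReal_mul (by positivity), gaussian]

/-- The averaging function is dominated by the Berezin transform. -/
theorem averaging_le_berezin {α t s r : ℝ} (hα : 0 < α) (ht : 0 < t) (hs : 0 ≤ s) (hr : 0 < r)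
    (μ : Measure (Cn n)) (w : Cn n) :
    averaging s r μ w ≤
      ENNReal.ofReal ((1 + r) ^ s * Real.exp (t * α / 2 * r ^ 2)) * berezin α t s μ w := by
  rw [averaging_eq, berezin_eq, ← setLIntegral_const, ← lintegral_const_mul' _ _
    ENNReal.ofReal_ne_top]
  refine (setLIntegral_mono' Metric.isOpen_ball.measurableSet fun z hz => ?_).trans
    (setLIntegral_le_lintegral _ _)
  have hz : ‖w - z‖ ≤ r := by
    rw [← dist_eq_norm, dist_comm]; exact (Metric.mem_ball.1 hz).le
  refine (ofReal_weight_neg_le hs hz).trans ?_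
  rw [ENNReal.ofReal_mul (by positivity), mul_assoc, mul_left_comm _ _ (gaussian _ _)]
  gcongr
  conv_lhs => rw [← mul_one (ENNReal.ofReal _)]
  gcongr
  rw [gaussian, ← ENNReal.ofReal_mul (Real.exp_pos _).le, ← Real.exp_add,
    ← ENNReal.ofReal_one]
  refine ENNReal.ofReal_le_ofReal (Real.one_le_exp ?_)
  rw [norm_sub_rev]
  have : ‖w - z‖ ^ 2 ≤ r ^ 2 := by gcongr
  have h2 : 0 < t * α / 2 := by positivity
  nlinarith

/-- A set of full volume is dense, so every point lies in a ball of finite μ-measure. This supplies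
the σ-finiteness that Tonelli requires for an arbitrary μ. -/
theorem isLocallyFiniteMeasure_of_ae {μ : Measure (Cn n)} {r : ℝ} (hr : 0 < r)
    (h : ∀ᵐ z : Cn n, μ (Metric.ball z r) ≠ ∞) : IsLocallyFiniteMeasure μ := by
  refine ⟨fun x => ?_⟩
  have hd : Dense {z : Cn n | μ (Metric.ball z r) ≠ ∞} := Measure.dense_of_ae h
  obtain ⟨z, hz, hzx⟩ := hd.exists_dist_lt x hr
  exact ⟨Metric.ball z r, Metric.isOpen_ball.mem_nhds hzx, lt_top_iff_ne_top.2 hz⟩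

theorem averaging_ne_top_iff {s r : ℝ} {μ : Measure (Cn n)} {z : Cn n} :
    averaging s r μ z ≠ ∞ ↔ μ (Metric.ball z r) ≠ ∞ := by
  rw [averaging, ne_eq, ne_eq, ENNReal.div_eq_top]
  simp [ofReal_weight_ne_zero s z]

theorem isLocallyFiniteMeasure_of_lintegral_averaging {s r σ : ℝ} (hσ : 0 < σ) (hr : 0 < r)
    {μ : Measure (Cn n)} (h : ∫⁻ z, averaging s r μ z ^ σ ≠ ∞) :
    IsLocallyFiniteMeasure μ := by
  refine isLocallyFiniteMeasure_of_ae hr ?_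
  filter_upwards [ae_lt_top ((measurable_averaging s r μ).pow_const σ) h] with z hz
  rw [← averaging_ne_top_iff (s := s)]
  intro h'
  rw [h', ENNReal.top_rpow_of_pos hσ] at hz
  exact lt_irrefl _ hz

/-- Either the transform is identically ∞, or it is finite at some w; in that case all balls about w
have finite measure and Tonelli's theorem applies. -/
theorem measurable_berezin {α t s : ℝ} (hα : 0 < α) (ht : 0 < t) (hs : 0 ≤ s)
    (μ : Measure (Cn n)) : Measurable (berezin α t s μ) := by
  by_cases h : ∀ w, berezin α t s μ w = ∞
  · rw [show berezin α t s μ = fun _ => ∞ from funext h]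
    exact measurable_const
  · push Not at h
    obtain ⟨w, hw⟩ := h
    have hfin : SigmaFinite μ := by
      have : IsLocallyFiniteMeasure μ := by
        refine ⟨fun x => ⟨Metric.ball w (dist x w + 1),
          Metric.isOpen_ball.mem_nhds (by simp), ?_⟩⟩
        rw [lt_top_iff_ne_top, ← averaging_ne_top_iff (s := s)]
        refine ne_top_of_le_ne_top ?_
          (averaging_le_berezin (r := dist x w + 1) hα ht hs (by positivity) μ w)
        exact ENNReal.mul_ne_top ENNReal.ofReal_ne_top hw
      infer_instance
    simp_rw [funext (berezin_eq α t s μ)]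
    refine Measurable.lintegral_prod_right' (f := fun x : Cn n × Cn n =>
      ENNReal.ofReal ((1 + ‖x.2‖) ^ (-s)) * gaussian (t * α / 2) (x.2 - x.1)) ?_
    refine Measurable.mul (ENNReal.measurable_ofReal.comp (by fun_prop)) ?_
    exact (measurable_gaussian _).comp (by fun_prop)

/-- Averaging over balls and Fubini: `∫ F dμ` is dominated through local mean values. -/
theorem lintegral_le_lintegral_ball {μ : Measure (Cn n)} [SFinite μ] {r : ℝ} {F G : Cn n → ℝ≥0∞}
    (hG : Measurable G) (h : ∀ z, F z ≤ ∫⁻ u in Metric.ball z r, G u) :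
    ∫⁻ z, F z ∂μ ≤ ∫⁻ u, G u * μ (Metric.ball u r) := by
  have hmeas : Measurable (Function.uncurry fun (z u : Cn n) =>
      (Metric.ball z r).indicator G u) := by
    have : (Function.uncurry fun (z u : Cn n) => (Metric.ball z r).indicator G u) =
        {x : Cn n × Cn n | dist x.2 x.1 < r}.indicator fun x => G x.2 := by
      ext ⟨z, u⟩; simp [Set.indicator, Function.uncurry]
    rw [this]
    exact (hG.comp measurable_snd).indicator
      (isOpen_lt (by fun_prop) continuous_const).measurableSet
  calc ∫⁻ z, F z ∂μ ≤ ∫⁻ z, ∫⁻ u, (Metric.ball z r).indicator G u ∂volume ∂μ := by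
        refine lintegral_mono fun z => (h z).trans_eq ?_
        rw [lintegral_indicator Metric.isOpen_ball.measurableSet]
    _ = ∫⁻ u, ∫⁻ z, (Metric.ball z r).indicator G u ∂μ := lintegral_lintegral_swap
        hmeas.aemeasurable
    _ = ∫⁻ u, G u * μ (Metric.ball u r) := by
        refine lintegral_congr fun u => ?_
        rw [← setLIntegral_const, ← lintegral_indicator Metric.isOpen_ball.measurableSet]
        refine lintegral_congr fun z => ?_
        simp [Set.indicator, dist_comm]

/-! ### Comparing Berezin transform, averages and lattice values. -/

/-- The Berezin transform is controlled by the averaging function in `L^σ`. -/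
theorem exists_lintegral_berezin_le {α t s r σ : ℝ} (hα : 0 < α) (ht : 0 < t) (hs : 0 ≤ s)
    (hr : 0 < r) (hσ : 1 < σ) :
    ∃ C : ℝ≥0∞, C ≠ ∞ ∧ ∀ μ : Measure (Cn n),
      ∫⁻ w, berezin α t s μ w ^ σ ≤ C * ∫⁻ w, averaging s r μ w ^ σ := by
  have hσ0 : 0 < σ := by linarith
  set b := t * α / 2
  have hb : 0 < b := by positivity
  set v := volume (Metric.ball (0 : Cn n) r)
  have hv : v ≠ 0 := (Metric.measure_ball_pos volume _ hr).ne'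
  have hv' : v ≠ ∞ := measure_ball_lt_top.ne
  set E := v⁻¹ * ENNReal.ofReal ((1 + r) ^ s) * ENNReal.ofReal (Real.exp (b * r ^ 2))
  have hE : E ≠ ∞ := ENNReal.mul_ne_top (ENNReal.mul_ne_top (ENNReal.inv_ne_top.2 hv)
    ENNReal.ofReal_ne_top) ENNReal.ofReal_ne_top
  set M := ∫⁻ z : Cn n, gaussian (b / 2) z
  have hM : M ≠ ∞ := (lintegral_gaussian_lt_top (half_pos hb)).ne
  set C := E ^ σ * (M ^ (σ - 1) * M)
  have hC : C ≠ ∞ := ENNReal.mul_ne_top (ENNReal.rpow_ne_top_of_nonneg hσ0.le hE)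
    (ENNReal.mul_ne_top (ENNReal.rpow_ne_top_of_nonneg (by linarith) hM) hM)
  -- Adding 1 keeps the constant nonzero, so that the bound reads ∞ ≤ ∞, and not ∞ ≤ 0 * ∞ = 0, when
  -- the averaging norm is infinite.
  refine ⟨C + 1, ENNReal.add_ne_top.2 ⟨hC, ENNReal.one_ne_top⟩, fun μ => ?_⟩
  by_cases hfin : ∫⁻ w, averaging s r μ w ^ σ = ∞
  · rw [hfin, ENNReal.mul_top (by simp)]
    exact le_top
  have := isLocallyFiniteMeasure_of_lintegral_averaging hσ0 hr hfin
  -- The integrand at z is replaced by its comparable values on D(z, r); Fubini then produces μ(D(u,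
  -- r)), hence a Gaussian convolution.
  have hpt : ∀ w, berezin α t s μ w ≤
      E * ∫⁻ u, gaussian (b / 2) (u - w) * averaging s r μ u := by
    intro w
    rw [berezin_eq]
    have hmG : Measurable fun u : Cn n => E * (ENNReal.ofReal ((1 + ‖u‖) ^ (-s)) *
        gaussian (b / 2) (u - w)) := by
      refine Measurable.const_mul (Measurable.mul
        (ENNReal.measurable_ofReal.comp (by fun_prop)) ?_) _
      exact (measurable_gaussian _).comp (by fun_prop)
    refine (lintegral_le_lintegral_ball (r := r) hmG fun z => ?_).trans_eq ?_
    · calc ENNReal.ofReal ((1 + ‖z‖) ^ (-s)) * gaussian b (z - w)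
          = ∫⁻ u in Metric.ball z r, v⁻¹ *
              (ENNReal.ofReal ((1 + ‖z‖) ^ (-s)) * gaussian b (z - w)) := by
            rw [setLIntegral_const, Measure.addHaar_ball_center, mul_comm _ (volume _), ← mul_assoc,
              ENNReal.mul_inv_cancel hv hv', one_mul]
        _ ≤ _ := by
            refine setLIntegral_mono' Metric.isOpen_ball.measurableSet fun u hu => ?_
            have hu : ‖z - u‖ ≤ r := by
              rw [← dist_eq_norm, dist_comm]; exact (Metric.mem_ball.1 hu).le
            calc v⁻¹ * (ENNReal.ofReal ((1 + ‖z‖) ^ (-s)) * gaussian b (z - w))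
                ≤ v⁻¹ * ((ENNReal.ofReal ((1 + r) ^ s) * ENNReal.ofReal ((1 + ‖u‖) ^ (-s))) *
                  (ENNReal.ofReal (Real.exp (b * r ^ 2)) * gaussian (b / 2) (u - w))) := by
                  gcongr
                  · exact ofReal_weight_neg_le hs hu
                  · exact gaussian_le_of_dist_le hb.le hu w
              _ = _ := by simp only [E]; ring
    · rw [← lintegral_const_mul' _ _ hE]
      refine lintegral_congr fun u => ?_
      rw [averaging_eq]
      ring
  calc ∫⁻ w, berezin α t s μ w ^ σ
      ≤ ∫⁻ w, E ^ σ * (∫⁻ u, gaussian (b / 2) (u - w) * averaging s r μ u) ^ σ := by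
        refine lintegral_mono fun w => ?_
        rw [← ENNReal.mul_rpow_of_nonneg _ _ hσ0.le]
        exact ENNReal.rpow_le_rpow (hpt w) hσ0.le
    _ = E ^ σ * ∫⁻ w, (∫⁻ u, gaussian (b / 2) (u - w) * averaging s r μ u) ^ σ :=
        lintegral_const_mul' _ _ (ENNReal.rpow_ne_top_of_nonneg hσ0.le hE)
    _ ≤ E ^ σ * (M ^ (σ - 1) * M * ∫⁻ u, averaging s r μ u ^ σ) := by
        gcongr
        refine lintegral_lintegral_mul_rpow_le (K := fun u w => gaussian (b / 2) (u - w)) ?_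
          (measurable_averaging s r μ) hσ (fun w => ?_) fun u => ?_
        · exact (measurable_gaussian _).comp (by fun_prop)
        · rw [lintegral_gaussian_sub_right]
        · rw [lintegral_gaussian_sub_left]
    _ ≤ (C + 1) * ∫⁻ w, averaging s r μ w ^ σ := by
        rw [← mul_assoc]
        gcongr
        exact le_self_add

/-- The averaging function is controlled in `L^σ` by its values on a lattice. -/
theorem exists_lintegral_averaging_le {s r r' σ : ℝ} (hs : 0 ≤ s) (hr' : 0 < r')
    (hσ : 0 < σ) :
    ∃ C : ℝ≥0∞, C ≠ ∞ ∧ ∀ z : ℕ → Cn n, IsHalfLattice r' z → ∀ μ : Measure (Cn n),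
      ∫⁻ w, averaging s r μ w ^ σ ≤ C * ∑' k, averaging s r' μ (z k) ^ σ := by
  obtain ⟨M, hM, h⟩ := exists_lintegral_tsum_gaussian_rpow_le (n := n) (b := 1) (ρ := r' / 2)
    one_pos (half_pos hr') hσ
  set R := r + r'
  set E := ENNReal.ofReal ((1 + R) ^ s) * ENNReal.ofReal (Real.exp (R ^ 2))
  have hE : E ≠ ∞ := ENNReal.mul_ne_top ENNReal.ofReal_ne_top ENNReal.ofReal_ne_top
  refine ⟨E ^ σ * M, ENNReal.mul_ne_top (ENNReal.rpow_ne_top_of_nonneg hσ.le hE) hM,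
    fun z hz μ => ?_⟩
  -- Only lattice points within R = r + r' of w contribute; there the Gaussian is at least e^{-R²},
  -- so the local sum is dominated by a Gaussian superposition.
  have hpt : ∀ w, averaging s r μ w ≤
      E * ∑' k, gaussian 1 (z k - w) * averaging s r' μ (z k) := by
    intro w
    have hcov : Metric.ball w r ⊆
        ⋃ k, Metric.ball (z k) r' ∩ Metric.ball w r := by
      rw [← Set.iUnion_inter, hz.covers, Set.univ_inter]
    rw [averaging_eq, ← ENNReal.tsum_mul_left]
    refine (mul_le_mul_right ((measure_mono hcov).trans (measure_iUnion_le _)) _).trans ?_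
    rw [← ENNReal.tsum_mul_left]
    refine ENNReal.tsum_le_tsum fun k => ?_
    rcases (Metric.ball (z k) r' ∩ Metric.ball w r).eq_empty_or_nonempty with he | ⟨x, hx⟩
    · rw [he]; simp
    · have hd : ‖w - z k‖ ≤ R := by
        have h1 := Metric.mem_ball.1 hx.1
        have h2 := Metric.mem_ball'.1 hx.2
        rw [← dist_eq_norm]
        have := dist_triangle w x (z k)
        simp only [R]
        linarith
      have hg : 1 ≤ ENNReal.ofReal (Real.exp (R ^ 2)) * gaussian 1 (z k - w) := by
        rw [gaussian, ← ENNReal.ofReal_mul (Real.exp_pos _).le, ← Real.exp_add,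
          ← ENNReal.ofReal_one]
        refine ENNReal.ofReal_le_ofReal (Real.one_le_exp ?_)
        rw [norm_sub_rev]
        have : ‖w - z k‖ ^ 2 ≤ R ^ 2 := by gcongr
        linarith
      calc ENNReal.ofReal ((1 + ‖w‖) ^ (-s)) * μ (Metric.ball (z k) r' ∩ Metric.ball w r)
          ≤ (ENNReal.ofReal ((1 + R) ^ s) * ENNReal.ofReal ((1 + ‖z k‖) ^ (-s))) *
              μ (Metric.ball (z k) r') * 1 := by
            rw [mul_one]
            gcongr
            · exact ofReal_weight_neg_le hs hd
            · exact Set.inter_subset_left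
        _ ≤ (ENNReal.ofReal ((1 + R) ^ s) * ENNReal.ofReal ((1 + ‖z k‖) ^ (-s))) *
              μ (Metric.ball (z k) r') *
              (ENNReal.ofReal (Real.exp (R ^ 2)) * gaussian 1 (z k - w)) := by gcongr
        _ = _ := by rw [averaging_eq]; simp only [E]; ring
  calc ∫⁻ w, averaging s r μ w ^ σ
      ≤ ∫⁻ w, E ^ σ * (∑' k, gaussian 1 (z k - w) * averaging s r' μ (z k)) ^ σ := by
        refine lintegral_mono fun w => ?_
        rw [← ENNReal.mul_rpow_of_nonneg _ _ hσ.le]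
        exact ENNReal.rpow_le_rpow (hpt w) hσ.le
    _ = E ^ σ * ∫⁻ w, (∑' k, gaussian 1 (z k - w) * averaging s r' μ (z k)) ^ σ :=
        lintegral_const_mul' _ _ (ENNReal.rpow_ne_top_of_nonneg hσ.le hE)
    _ ≤ _ := by
        rw [mul_assoc]
        gcongr
        exact h z hz.disjoint _

/-- Half-lattices exist in every positive dimension. -/
theorem exists_isHalfLattice (hn : 0 < n) {r : ℝ} (hr : 0 < r) :
    ∃ z : ℕ → Cn n, IsHalfLattice r z := by
  -- A maximal r-separated set: separation gives disjoint half-balls, maximality gives the covering.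
  obtain ⟨S, hS⟩ := zorn_subset
    {S : Set (Cn n) | S.Pairwise fun x y => r ≤ dist x y} (fun c hc hchain => by
      refine ⟨⋃₀ c, ?_, fun s hs => Set.subset_sUnion_of_mem hs⟩
      exact (Set.pairwise_sUnion hchain.directedOn).2 fun s hs => hc hs)
  have hsep : S.Pairwise fun x y => r ≤ dist x y := hS.prop
  have hcov : ∀ w, ∃ x ∈ S, dist w x < r := by
    intro w
    by_contra! hw
    have hwS : w ∉ S := fun h => by
      have := hw w h
      rw [dist_self] at this
      linarith
    have hins : (insert w S).Pairwise fun x y => r ≤ dist x y :=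
      hsep.insert fun x hx _ => ⟨hw x hx, by rw [dist_comm]; exact hw x hx⟩
    exact hwS (hS.le_of_ge hins (Set.subset_insert w S) (Set.mem_insert w S))
  have hdisj : S.PairwiseDisjoint fun x => Metric.ball x (r / 2) := fun x hx y hy hxy =>
    Metric.ball_disjoint_ball (by have := hsep hx hy hxy; linarith)
  have hcount : S.Countable := hdisj.countable_of_isOpen (fun _ _ => Metric.isOpen_ball)
    fun x _ => ⟨x, Metric.mem_ball_self (half_pos hr)⟩
  -- Enumerating S injectively by ℕ needs S infinite. Finitely many balls cannot cover the unbounded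
  -- space, which is where n > 0 enters.
  have hinf : S.Infinite := by
    intro hfin
    have : Nonempty (Fin n) := ⟨⟨0, hn⟩⟩
    have hb : Bornology.IsBounded (Set.univ : Set (Cn n)) := by
      refine ((Bornology.isBounded_biUnion hfin).2
        fun x _ => Metric.isBounded_ball (x := x) (r := r)).subset fun w _ => ?_
      obtain ⟨x, hx, hd⟩ := hcov w
      exact Set.mem_biUnion hx hd
    exact NormedSpace.unbounded_univ ℂ (Cn n) hb
  have : Countable S := hcount.to_subtype
  have : Infinite S := hinf.to_subtype
  obtain ⟨_⟩ := nonempty_denumerable S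
  set e := (Denumerable.eqv S).symm
  refine ⟨fun k => e k, Subtype.val_injective.comp e.injective, ?_, fun j k hjk => ?_⟩
  · refine Set.eq_univ_of_forall fun w => ?_
    obtain ⟨x, hx, hd⟩ := hcov w
    refine Set.mem_iUnion.2 ⟨e.symm ⟨x, hx⟩, ?_⟩
    simpa using hd
  · exact hdisj (e j).2 (e k).2 fun h => hjk (e.injective (Subtype.ext h))

/-! ### The Fock–Sobolev norm and boundedness of the embedding. -/

theorem carlesonIntegral_eq (α q : ℝ) (μ : Measure (Cn n)) (f : Cn n → ℂ) :
    carlesonIntegral α q μ f = ∫⁻ z, ‖f z‖ₑ ^ q * gaussian (α * q / 2) z ∂μ := rfl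

theorem fockSobolevNorm_rpow (m : ℕ) (α : ℝ) {p : ℝ} (hp : 0 < p) (f : Cn n → ℂ) :
    fockSobolevNorm m α p f ^ p = ENNReal.ofReal (normConst n m α p) *
      ∫⁻ z : Cn n, ENNReal.ofReal (‖z‖ ^ ((m : ℝ) * p)) * ‖f z‖ₑ ^ p *
        gaussian (α * p / 2) z := by
  rw [fockSobolevNorm, ← ENNReal.rpow_mul, one_div_mul_cancel hp.ne', ENNReal.rpow_one]
  rfl

theorem normConst_pos (hn : 0 < n) (m : ℕ) {α p : ℝ} (hα : 0 < α) (hp : 0 < p) :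
    0 < normConst n m α p := by
  have hn' : (0 : ℝ) < n := by exact_mod_cast hn
  have h1 := Real.Gamma_pos_of_pos hn'
  have h2 : 0 < Real.Gamma ((m : ℝ) * p / 2 + n) := Real.Gamma_pos_of_pos (by positivity)
  have := Real.pi_pos
  rw [normConst]
  positivity

theorem volume_annulus_ne_zero (hn : 0 < n) :
    volume {w : Cn n | ‖w‖ ∈ Set.Ioo (2 : ℝ) 4} ≠ 0 := by
  refine (IsOpen.measure_pos _ (isOpen_Ioo.preimage continuous_norm)
    ⟨EuclideanSpace.single ⟨0, hn⟩ 3, ?_⟩).ne'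
  simp only [Set.mem_preimage, PiLp.norm_single]
  norm_num

/-- The weight `|z|^{mp}` in the Fock–Sobolev norm may be replaced by `(1 + |z|)^{mp}`. -/
theorem exists_lintegral_weight_le (hn : 0 < n) (m : ℕ) {α p : ℝ} (hα : 0 < α) (hp : 0 < p) :
    ∃ C : ℝ≥0∞, C ≠ ∞ ∧ ∀ f : Cn n → ℂ, Differentiable ℂ f →
      ∫⁻ z : Cn n, ENNReal.ofReal ((1 + ‖z‖) ^ ((m : ℝ) * p)) *
        (‖f z‖ₑ ^ p * gaussian (α * p / 2) z) ≤ C * fockSobolevNorm m α p f ^ p := by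
  -- Inside the unit ball |z|^{mp} degenerates. The submean inequality is therefore taken over the
  -- annulus 2 < |w - z| < 4, on which |w| ≥ 1 when |z| < 1. Outside the unit ball, 1 + |z| ≤ 2|z|
  -- suffices.
  set v := volume {w : Cn n | ‖w‖ ∈ Set.Ioo (2 : ℝ) 4}
  have hv : v ≠ 0 := volume_annulus_ne_zero hn
  have hv' : v ≠ ∞ := by
    refine ne_top_of_le_ne_top (measure_ball_lt_top (x := (0 : Cn n)) (r := 4)).ne
      (measure_mono fun w hw => ?_)
    simpa using hw.2
  set s : ℝ := (m : ℝ) * p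
  have hs : 0 ≤ s := by positivity
  set D := v⁻¹ * ENNReal.ofReal (Real.exp (α * p / 2 * 4 ^ 2))
  have hD : D ≠ ∞ := ENNReal.mul_ne_top (ENNReal.inv_ne_top.2 hv) ENNReal.ofReal_ne_top
  set T := ENNReal.ofReal ((2 : ℝ) ^ s)
  set N := ENNReal.ofReal (normConst n m α p)
  have hN : N ≠ 0 := by simpa [N] using normConst_pos hn m hα hp
  set V := volume (Metric.ball (0 : Cn n) 1)
  have hV : V ≠ ∞ := measure_ball_lt_top.ne
  refine ⟨(T * D * V + T) * N⁻¹, ENNReal.mul_ne_top (ENNReal.add_ne_top.2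
    ⟨ENNReal.mul_ne_top (ENNReal.mul_ne_top ENNReal.ofReal_ne_top hD) hV,
      ENNReal.ofReal_ne_top⟩) (ENNReal.inv_ne_top.2 hN), fun f hf => ?_⟩
  rw [fockSobolevNorm_rpow m α hp, mul_assoc, ← mul_assoc N⁻¹,
    ENNReal.inv_mul_cancel hN ENNReal.ofReal_ne_top, one_mul]
  set g : Cn n → ℝ≥0∞ := fun z => ‖f z‖ₑ ^ p * gaussian (α * p / 2) z
  set I := ∫⁻ z : Cn n, ENNReal.ofReal (‖z‖ ^ s) * ‖f z‖ₑ ^ p * gaussian (α * p / 2) z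
  have hI : I = ∫⁻ z : Cn n, ENNReal.ofReal (‖z‖ ^ s) * g z :=
    lintegral_congr fun z => mul_assoc _ _ _
  have hball : ∀ z ∈ Metric.ball (0 : Cn n) 1, g z ≤ D * I := by
    intro z hz
    have h1 := volume_mul_gaussian_le hf hα hp (s := Set.Ioo 2 4) measurableSet_Ioo (R := 4)
      (fun x hx => by rw [abs_of_pos (by linarith [hx.1])]; exact hx.2.le) z
    have h2 : ∫⁻ w in {w : Cn n | ‖w - z‖ ∈ Set.Ioo (2 : ℝ) 4}, g w ≤ I := by
      rw [hI]
      refine (setLIntegral_mono' ?_ fun w hw => ?_).trans (setLIntegral_le_lintegral _ _)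
      · exact (measurable_norm.comp (measurable_id.sub_const z)) measurableSet_Ioo
      · have hz : ‖z‖ < 1 := by simpa using hz
        have hw1 : 1 ≤ ‖w‖ := by
          have := norm_sub_le w z
          have := hw.1
          linarith
        have : (1 : ℝ≥0∞) ≤ ENNReal.ofReal (‖w‖ ^ s) := by
          rw [← ENNReal.ofReal_one]
          exact ENNReal.ofReal_le_ofReal (Real.one_le_rpow hw1 hs)
        calc g w = 1 * g w := (one_mul _).symm
          _ ≤ _ := by gcongr
    rw [ENNReal.mul_le_iff_le_inv hv hv'] at h1
    refine h1.trans ?_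
    rw [← mul_assoc]
    gcongr
  rw [← lintegral_add_compl _ (measurableSet_ball (x := (0 : Cn n)) (ε := 1)), add_mul]
  refine add_le_add ?_ ?_
  · calc ∫⁻ z in Metric.ball (0 : Cn n) 1, ENNReal.ofReal ((1 + ‖z‖) ^ s) * g z
        ≤ ∫⁻ z in Metric.ball (0 : Cn n) 1, T * (D * I) := by
          refine setLIntegral_mono' measurableSet_ball fun z hz => ?_
          refine mul_le_mul' (ENNReal.ofReal_le_ofReal ?_) (hball z hz)
          have hz : ‖z‖ < 1 := by simpa using hz
          exact Real.rpow_le_rpow (by positivity) (by linarith) hs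
      _ = T * D * V * I := by
          rw [setLIntegral_const]; ring
  · calc ∫⁻ z in (Metric.ball (0 : Cn n) 1)ᶜ, ENNReal.ofReal ((1 + ‖z‖) ^ s) * g z
        ≤ ∫⁻ z in (Metric.ball (0 : Cn n) 1)ᶜ, T * (ENNReal.ofReal (‖z‖ ^ s) * g z) := by
          refine setLIntegral_mono' measurableSet_ball.compl fun z hz => ?_
          have hz : 1 ≤ ‖z‖ := by simpa using hz
          rw [← mul_assoc T]
          refine mul_le_mul' ?_ le_rfl
          rw [← ENNReal.ofReal_mul (by positivity), ← Real.mul_rpow (by norm_num) (norm_nonneg z)]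
          exact ENNReal.ofReal_le_ofReal (Real.rpow_le_rpow (by positivity) (by linarith) hs)
      _ = T * ∫⁻ z in (Metric.ball (0 : Cn n) 1)ᶜ, ENNReal.ofReal (‖z‖ ^ s) * g z :=
          lintegral_const_mul' _ _ ENNReal.ofReal_ne_top
      _ ≤ T * I := by
          rw [hI]
          gcongr
          exact Measure.restrict_le_self

/-- Point evaluations are bounded by the Fock–Sobolev norm. -/
theorem exists_enorm_rpow_mul_gaussian_le (hn : 0 < n) (m : ℕ) {α p : ℝ} (hα : 0 < α)
    (hp : 0 < p) :
    ∃ C : ℝ≥0∞, C ≠ ∞ ∧ ∀ f : Cn n → ℂ, Differentiable ℂ f → ∀ z,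
      ‖f z‖ₑ ^ p * gaussian (α * p / 2) z ≤ C * fockSobolevNorm m α p f ^ p := by
  obtain ⟨C, hC, h⟩ := exists_lintegral_weight_le hn m hα hp
  set v := volume (Metric.ball (0 : Cn n) 1)
  have hv : v ≠ 0 := (Metric.measure_ball_pos volume _ one_pos).ne'
  have hv' : v ≠ ∞ := measure_ball_lt_top.ne
  refine ⟨v⁻¹ * ENNReal.ofReal (Real.exp (α * p / 2 * 1 ^ 2)) * C,
    ENNReal.mul_ne_top (ENNReal.mul_ne_top (ENNReal.inv_ne_top.2 hv) ENNReal.ofReal_ne_top) hC,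
    fun f hf z => ?_⟩
  have h1 := volume_ball_mul_gaussian_le hf hα hp (r := 1) z
  rw [ENNReal.mul_le_iff_le_inv hv hv'] at h1
  refine h1.trans ?_
  rw [mul_assoc, mul_assoc]
  gcongr
  refine (setLIntegral_le_lintegral _ _).trans (le_trans (lintegral_mono fun w => ?_) (h f hf))
  have : (1 : ℝ≥0∞) ≤ ENNReal.ofReal ((1 + ‖w‖) ^ ((m : ℝ) * p)) := by
    rw [← ENNReal.ofReal_one]
    exact ENNReal.ofReal_le_ofReal (Real.one_le_rpow (by linarith [norm_nonneg w]) (by positivity))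
  calc _ = 1 * (‖f w‖ₑ ^ p * gaussian (α * p / 2) w) := (one_mul _).symm
    _ ≤ _ := by gcongr

theorem holderConjugate_div {p q : ℝ} (hq : 0 < q) (hqp : q < p) :
    (p / q).HolderConjugate (p / (p - q)) := by
  have hp : 0 < p := hq.trans hqp
  rw [Real.holderConjugate_iff]
  refine ⟨(one_lt_div hq).2 hqp, ?_⟩
  rw [inv_div, inv_div, ← add_div]
  field_simp
  ring

/-- The embedding is bounded when the averaging function lies in `L^{p/(p-q)}`. -/
theorem exists_carlesonIntegral_le (hn : 0 < n) (m : ℕ) {α p q r : ℝ} (hα : 0 < α) (hq : 0 < q)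
    (hqp : q < p) (hr : 0 < r) :
    ∃ C : ℝ≥0∞, C ≠ ∞ ∧ ∀ μ : Measure (Cn n),
      ∫⁻ w, averaging (m * q) r μ w ^ (p / (p - q)) ≠ ∞ →
      ∀ f : Cn n → ℂ, Differentiable ℂ f →
        carlesonIntegral α q μ f ≤
          C * (∫⁻ w, averaging (m * q) r μ w ^ (p / (p - q))) ^ (1 / (p / (p - q))) *
            fockSobolevNorm m α p f ^ q := by
  have hp : 0 < p := hq.trans hqp
  have hconj := holderConjugate_div hq hqp
  set σ := p / (p - q)
  have hσ : 0 < σ := hconj.symm.pos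
  obtain ⟨C, hC, h⟩ := exists_lintegral_weight_le hn m hα hp
  set v := volume (Metric.ball (0 : Cn n) r)
  have hv : v ≠ 0 := (Metric.measure_ball_pos volume _ hr).ne'
  have hv' : v ≠ ∞ := measure_ball_lt_top.ne
  set E := v⁻¹ * ENNReal.ofReal (Real.exp (α * q / 2 * r ^ 2))
  have hE : E ≠ ∞ := ENNReal.mul_ne_top (ENNReal.inv_ne_top.2 hv) ENNReal.ofReal_ne_top
  refine ⟨E * C ^ (1 / (p / q)), ENNReal.mul_ne_top hE
    (ENNReal.rpow_ne_top_of_nonneg (by positivity) hC), fun μ hμ f hf => ?_⟩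
  have := isLocallyFiniteMeasure_of_lintegral_averaging hσ hr hμ
  have hmf : Measurable fun u => ‖f u‖ₑ ^ q * gaussian (α * q / 2) u :=
    (hf.continuous.measurable.enorm.pow_const q).mul (measurable_gaussian _)
  have hmw : Measurable fun u : Cn n => ENNReal.ofReal ((1 + ‖u‖) ^ ((m : ℝ) * q)) :=
    ENNReal.measurable_ofReal.comp (by fun_prop)
  have hF : ∀ u : Cn n, (ENNReal.ofReal ((1 + ‖u‖) ^ ((m : ℝ) * q)) *
      (‖f u‖ₑ ^ q * gaussian (α * q / 2) u)) ^ (p / q) =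
      ENNReal.ofReal ((1 + ‖u‖) ^ ((m : ℝ) * p)) * (‖f u‖ₑ ^ p * gaussian (α * p / 2) u) := by
    intro u
    have hpq : 0 ≤ p / q := by positivity
    rw [ENNReal.mul_rpow_of_nonneg _ _ hpq, ENNReal.mul_rpow_of_nonneg _ _ hpq, gaussian_rpow,
      ← ENNReal.rpow_mul, mul_div_cancel₀ _ hq.ne', ENNReal.ofReal_rpow_of_nonneg (by positivity)
      hpq, ← Real.rpow_mul (by positivity)]
    have h1 : (m : ℝ) * q * (p / q) = m * p := by field_simp
    have h2 : α * q / 2 * (p / q) = α * p / 2 := by field_simp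
    rw [h1, h2]
  calc carlesonIntegral α q μ f
      ≤ ∫⁻ u, E * (‖f u‖ₑ ^ q * gaussian (α * q / 2) u) * μ (Metric.ball u r) := by
        rw [carlesonIntegral_eq]
        refine lintegral_le_lintegral_ball (hmf.const_mul E) fun z => ?_
        rw [lintegral_const_mul' _ _ hE]
        have h1 := volume_ball_mul_gaussian_le hf hα hq (r := r) z
        rw [ENNReal.mul_le_iff_le_inv hv hv', ← mul_assoc] at h1
        exact h1
    -- The weight (1 + |u|)^{mq} and its inverse are inserted: one goes to f, the other completes
    -- the averaging function, and Hölder separates them.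
    _ = E * ∫⁻ u, ENNReal.ofReal ((1 + ‖u‖) ^ ((m : ℝ) * q)) *
          (‖f u‖ₑ ^ q * gaussian (α * q / 2) u) * averaging (m * q) r μ u := by
        rw [← lintegral_const_mul' _ _ hE]
        refine lintegral_congr fun u => ?_
        rw [averaging_eq]
        have := ofReal_weight_mul_neg ((m : ℝ) * q) u
        calc E * (‖f u‖ₑ ^ q * gaussian (α * q / 2) u) * μ (Metric.ball u r)
            = E * (‖f u‖ₑ ^ q * gaussian (α * q / 2) u) * μ (Metric.ball u r) * 1 := by
              rw [mul_one]
          _ = _ := by rw [← this]; ring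
    _ ≤ E * ((∫⁻ u, ENNReal.ofReal ((1 + ‖u‖) ^ ((m : ℝ) * p)) *
          (‖f u‖ₑ ^ p * gaussian (α * p / 2) u)) ^ (1 / (p / q)) *
          (∫⁻ u, averaging (m * q) r μ u ^ σ) ^ (1 / σ)) := by
        gcongr
        have := ENNReal.lintegral_mul_le_Lp_mul_Lq volume hconj (hmw.mul hmf).aemeasurable
          (measurable_averaging (m * q) r μ).aemeasurable
        simp only [Pi.mul_apply, hF] at this
        exact this
    _ ≤ E * ((C * fockSobolevNorm m α p f ^ p) ^ (1 / (p / q)) *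
          (∫⁻ u, averaging (m * q) r μ u ^ σ) ^ (1 / σ)) := by
        gcongr
        exact h f hf
    _ = _ := by
        rw [ENNReal.mul_rpow_of_nonneg _ _ (by positivity), ← ENNReal.rpow_mul]
        have : p * (1 / (p / q)) = q := by field_simp
        rw [this]
        ring

/-! ### Finite exponential sums belong to the Fock–Sobolev space -/

/-- `z ↦ ∑ₖ aₖ exp ⟨wₖ, z⟩`. -/
noncomputable def expSum {ι : Type*} [Fintype ι] (w : ι → Cn n) (a : ι → ℂ) : Cn n → ℂ :=
  fun z => ∑ k, a k * Complex.exp (inner ℂ (w k) z)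

variable {ι : Type*} [Fintype ι]

theorem hasFDerivAt_expSum (w : ι → Cn n) (a : ι → ℂ) (z : Cn n) :
    HasFDerivAt (expSum w a)
      (∑ k, a k • (Complex.exp (inner ℂ (w k) z) • innerSL ℂ (w k))) z := by
  refine HasFDerivAt.fun_sum fun k _ => ?_
  exact ((innerSL ℂ (w k)).hasFDerivAt.cexp).const_mul (a k)

theorem differentiable_expSum (w : ι → Cn n) (a : ι → ℂ) : Differentiable ℂ (expSum w a) :=
  fun z => (hasFDerivAt_expSum w a z).differentiableAt

/-- Exponential sums with fixed frequencies are closed under differentiation, so membership in the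
Fock–Sobolev space needs only a zeroth-order Fock norm estimate. -/
theorem partialDeriv_expSum (w : ι → Cn n) (a : ι → ℂ) (j : Fin n) :
    partialDeriv j (expSum w a) =
      expSum w fun k => a k * inner ℂ (w k) (EuclideanSpace.single j (1 : ℂ)) := by
  funext z
  rw [partialDeriv, (hasFDerivAt_expSum w a z).fderiv, expSum]
  simp only [_root_.sum_apply, _root_.smul_apply, smul_eq_mul,
    innerSL_apply_apply]
  exact Finset.sum_congr rfl fun k _ => by ring

theorem multiDeriv_induction {P : (Cn n → ℂ) → Prop} (hP : ∀ j f, P f → P (partialDeriv j f))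
    (β : Fin n → ℕ) {f : Cn n → ℂ} (hf : P f) : P (multiDeriv β f) := by
  rw [multiDeriv]
  induction List.finRange n with
  | nil => exact hf
  | cons j l ih =>
    rw [List.foldr_cons]
    induction β j with
    | zero => exact ih
    | succ k ihk =>
      rw [Function.iterate_succ_apply']
      exact hP j _ ihk

theorem fockNorm_expSum_lt_top {α p : ℝ} (hα : 0 < α) (hp : 0 < p) (w : ι → Cn n) (a : ι → ℂ) :
    fockNorm α p (expSum w a) < ∞ := by
  set A := ∑ k, ‖a k‖
  set B := ∑ k, ‖w k‖
  have hA : 0 ≤ A := Finset.sum_nonneg fun _ _ => norm_nonneg _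
  have hB : 0 ≤ B := Finset.sum_nonneg fun _ _ => norm_nonneg _
  have hbound : ∀ z, ‖expSum w a z‖ ≤ A * Real.exp (B * ‖z‖) := by
    intro z
    refine (norm_sum_le _ _).trans ?_
    rw [Finset.sum_mul]
    refine Finset.sum_le_sum fun k _ => ?_
    rw [norm_mul, Complex.norm_exp]
    gcongr
    refine (Complex.re_le_norm _).trans ((norm_inner_le_norm _ _).trans ?_)
    gcongr
    exact Finset.single_le_sum (f := fun k => ‖w k‖) (fun _ _ => norm_nonneg _) (Finset.mem_univ k)
  refine ENNReal.rpow_lt_top_of_nonneg (by positivity) (ENNReal.mul_ne_top ENNReal.ofReal_ne_top ?_)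
  -- Half of the available exponent αp/2; the other half absorbs e^{Bp|z|}.
  set b := α * p / 4
  have hb : 0 < b := by positivity
  set D := A ^ p * Real.exp ((B * p) ^ 2 / (4 * b))
  refine ne_top_of_le_ne_top (ENNReal.mul_ne_top (ENNReal.ofReal_ne_top (r := D))
    (lintegral_gaussian_lt_top (n := n) hb).ne) ?_
  rw [← lintegral_const_mul' _ _ ENNReal.ofReal_ne_top]
  refine lintegral_mono fun z => ?_
  simp only
  rw [← ofReal_norm, ENNReal.ofReal_rpow_of_nonneg (norm_nonneg _) hp.le, gaussian,
    ← ENNReal.ofReal_mul (by positivity), ← ENNReal.ofReal_mul (by positivity)]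
  refine ENNReal.ofReal_le_ofReal ?_
  calc ‖expSum w a z‖ ^ p * Real.exp (-(α * p / 2) * ‖z‖ ^ 2)
      ≤ (A * Real.exp (B * ‖z‖)) ^ p * Real.exp (-(α * p / 2) * ‖z‖ ^ 2) := by
        gcongr
        exact hbound z
    _ = A ^ p * Real.exp (B * ‖z‖ * p + -(α * p / 2) * ‖z‖ ^ 2) := by
        rw [Real.mul_rpow hA (Real.exp_pos _).le, ← Real.exp_mul, Real.exp_add, mul_assoc]
    _ ≤ A ^ p * Real.exp ((B * p) ^ 2 / (4 * b) + -b * ‖z‖ ^ 2) := by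
        refine mul_le_mul_of_nonneg_left (Real.exp_le_exp.2 ?_) (by positivity)
        have h2 : (B * p) ^ 2 / (4 * b) + b * ‖z‖ ^ 2 - B * ‖z‖ * p =
            (B * p - 2 * b * ‖z‖) ^ 2 / (4 * b) := by
          field_simp
          ring
        have h3 : 0 ≤ (B * p - 2 * b * ‖z‖) ^ 2 / (4 * b) := by positivity
        have h4 : α * p / 2 = 2 * b := by simp only [b]; ring
        rw [h4]
        linarith
    _ = _ := by rw [Real.exp_add, ← mul_assoc]

theorem memFockSobolev_expSum (m : ℕ) {α p : ℝ} (hα : 0 < α) (hp : 0 < p) (w : ι → Cn n)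
    (a : ι → ℂ) : MemFockSobolev m α p (expSum w a) := by
  refine ⟨differentiable_expSum w a, ENNReal.sum_lt_top.2 fun β _ => ?_⟩
  obtain ⟨a', ha'⟩ := multiDeriv_induction (P := fun f => ∃ a', f = expSum w a')
    (by rintro j f ⟨a', rfl⟩; exact ⟨_, partialDeriv_expSum w a' j⟩) β ⟨a, rfl⟩
  rw [ha']
  exact fockNorm_expSum_lt_top hα hp w a'

/-! ### Scalar multiples -/

theorem multiDeriv_const_smul (c : ℂ) (β : Fin n → ℕ) (f : Cn n → ℂ) :
    multiDeriv β (c • f) = c • multiDeriv β f := by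
  have hpd : ∀ (j : Fin n) (g : Cn n → ℂ), partialDeriv j (c • g) = c • partialDeriv j g := by
    intro j g
    funext z
    simp only [partialDeriv, Pi.smul_apply]
    rw [fderiv_const_smul_field]
    rfl
  simp only [multiDeriv]
  induction List.finRange n with
  | nil => rfl
  | cons j l ih =>
    rw [List.foldr_cons, List.foldr_cons, ih]
    induction β j with
    | zero => rfl
    | succ k ihk => rw [Function.iterate_succ_apply', Function.iterate_succ_apply', ihk, hpd]

theorem fockNorm_const_smul_lt_top {α p : ℝ} (hp : 0 < p) (c : ℂ) {f : Cn n → ℂ}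
    (hf : fockNorm α p f < ∞) (h0 : 0 < α) : fockNorm α p (c • f) < ∞ := by
  have hne : ENNReal.ofReal ((α * p / (2 * Real.pi)) ^ n) ≠ 0 := by
    have := Real.pi_pos
    have : 0 < (α * p / (2 * Real.pi)) ^ n := by positivity
    simpa using this
  have h1p : 0 < 1 / p := by positivity
  rw [fockNorm, ENNReal.rpow_lt_top_iff_of_pos h1p] at hf ⊢
  have hint := (ENNReal.lt_top_of_mul_ne_top_right hf.ne hne).ne
  refine ENNReal.mul_lt_top ENNReal.ofReal_lt_top (lt_top_iff_ne_top.2 ?_)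
  refine ne_top_of_le_ne_top (ENNReal.mul_ne_top
    (ENNReal.rpow_ne_top_of_nonneg hp.le (enorm_ne_top (x := c))) hint) ?_
  rw [← lintegral_const_mul' _ _ (ENNReal.rpow_ne_top_of_nonneg hp.le enorm_ne_top)]
  refine lintegral_mono fun z => ?_
  simp only [Pi.smul_apply, enorm_smul]
  rw [ENNReal.mul_rpow_of_nonneg _ _ hp.le, mul_assoc]

theorem MemFockSobolev.const_smul {m : ℕ} {α p : ℝ} (hα : 0 < α) (hp : 0 < p) {f : Cn n → ℂ}
    (hf : MemFockSobolev m α p f) (c : ℂ) : MemFockSobolev m α p (c • f) := by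
  refine ⟨hf.1.const_smul c, ENNReal.sum_lt_top.2 fun β hβ => ?_⟩
  rw [multiDeriv_const_smul]
  exact fockNorm_const_smul_lt_top hp c (ENNReal.sum_lt_top.1 hf.2 β hβ) hα

theorem carlesonIntegral_const_smul (α : ℝ) {q : ℝ} (hq : 0 < q) (μ : Measure (Cn n)) (c : ℂ)
    (f : Cn n → ℂ) : carlesonIntegral α q μ (c • f) = ‖c‖ₑ ^ q * carlesonIntegral α q μ f := by
  rw [carlesonIntegral, carlesonIntegral,
    ← lintegral_const_mul' _ _ (ENNReal.rpow_ne_top_of_nonneg hq.le enorm_ne_top)]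
  refine lintegral_congr fun z => ?_
  rw [Pi.smul_apply, enorm_smul, ENNReal.mul_rpow_of_nonneg _ _ hq.le, mul_assoc]

theorem fockSobolevNorm_const_smul (m : ℕ) (α : ℝ) {p : ℝ} (hp : 0 < p) (c : ℂ)
    (f : Cn n → ℂ) : fockSobolevNorm m α p (c • f) = ‖c‖ₑ * fockSobolevNorm m α p f := by
  have h1p : 0 ≤ 1 / p := by positivity
  have hc : ‖c‖ₑ = (‖c‖ₑ ^ p) ^ (1 / p) := by
    rw [← ENNReal.rpow_mul, mul_one_div_cancel hp.ne', ENNReal.rpow_one]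
  rw [fockSobolevNorm, fockSobolevNorm, hc, ← ENNReal.mul_rpow_of_nonneg _ _ h1p,
    mul_left_comm (‖c‖ₑ ^ p),
    ← lintegral_const_mul' _ _ (ENNReal.rpow_ne_top_of_nonneg hp.le enorm_ne_top)]
  congr 2
  refine lintegral_congr fun z => ?_
  rw [Pi.smul_apply, enorm_smul, ENNReal.mul_rpow_of_nonneg _ _ hp.le]
  ring

/-! ### Random sums of normalised kernels. -/

/-- Averaging over random signs dominates each single term. -/
theorem card_mul_enorm_rpow_le {ι : Type*} [Fintype ι] [DecidableEq ι] (a : ι → ℂ) (j : ι)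
    {q : ℝ} (hq : 0 < q) :
    (Fintype.card (ι → ℤˣ) : ℝ≥0∞) * ‖a j‖ₑ ^ q ≤
      2 * ∑ ε : ι → ℤˣ, ‖∑ i, ((ε i : ℤ) : ℂ) * a i‖ₑ ^ q := by
  set S : (ι → ℤˣ) → ℂ := fun ε => ∑ i, ((ε i : ℤ) : ℂ) * a i
  -- Flipping the j-th sign changes the sum by 2 ε_j a_j, so one sum of each pair has modulus at
  -- least |a_j|. Reindexing by the flip leaves the total unchanged; this elementary bound stands in
  -- for Khinchine's inequality.
  set u : ι → ℤˣ := Function.update 1 j (-1)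
  have hS : ∀ ε, S ε - S (u * ε) = 2 * (((ε j : ℤ) : ℂ) * a j) := by
    intro ε
    simp only [S, ← Finset.sum_sub_distrib]
    rw [Finset.sum_eq_single j]
    · simp [u]; ring
    · intro i _ hij
      simp [u, Function.update_of_ne hij]
    · simp
  have hpt : ∀ ε, ‖a j‖ₑ ^ q ≤ ‖S ε‖ₑ ^ q + ‖S (u * ε)‖ₑ ^ q := by
    intro ε
    have hn : ‖((ε j : ℤ) : ℂ)‖ = 1 := by
      rcases Int.units_eq_one_or (ε j) with h | h <;> simp [h]
    have h1 : 2 * ‖a j‖ ≤ ‖S ε‖ + ‖S (u * ε)‖ := by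
      have := norm_sub_le (S ε) (S (u * ε))
      rw [hS, norm_mul, norm_mul, hn] at this
      simpa using this
    rcases le_total ‖a j‖ ‖S ε‖ with h | h
    · exact (ENNReal.rpow_le_rpow (enorm_le_iff_norm_le.2 h) hq.le).trans le_self_add
    · have h2 : ‖a j‖ ≤ ‖S (u * ε)‖ := by linarith
      exact (ENNReal.rpow_le_rpow (enorm_le_iff_norm_le.2 h2) hq.le).trans le_add_self
  calc (Fintype.card (ι → ℤˣ) : ℝ≥0∞) * ‖a j‖ₑ ^ q
      = ∑ _ε : ι → ℤˣ, ‖a j‖ₑ ^ q := by simp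
    _ ≤ ∑ ε, (‖S ε‖ₑ ^ q + ‖S (u * ε)‖ₑ ^ q) := Finset.sum_le_sum fun ε _ => hpt ε
    _ = 2 * ∑ ε, ‖S ε‖ₑ ^ q := by
        rw [Finset.sum_add_distrib,
          show ∑ ε, ‖S (u * ε)‖ₑ ^ q = ∑ ε, ‖S ε‖ₑ ^ q from
            Equiv.sum_comp (Equiv.mulLeft u) fun ε => ‖S ε‖ₑ ^ q, two_mul]

/-- The coefficient of the weighted normalised reproducing kernel at `w`. -/
noncomputable def kernelCoeff (m : ℕ) (α : ℝ) (w : Cn n) : ℝ :=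
  (1 + ‖w‖) ^ (-(m : ℝ)) * Real.exp (-(α / 2) * ‖w‖ ^ 2)

/-- Completing the square turns the weighted modulus of a kernel into a Gaussian bump centred at w.
-/
theorem enorm_kernel_mul_gaussian (m : ℕ) (α : ℝ) (w z : Cn n) :
    ‖(kernelCoeff m α w : ℂ) * Complex.exp (inner ℂ ((α : ℂ) • w) z)‖ₑ * gaussian (α / 2) z =
      ENNReal.ofReal ((1 + ‖w‖) ^ (-(m : ℝ))) * gaussian (α / 2) (w - z) := by
  have h0 : 0 ≤ kernelCoeff m α w := by rw [kernelCoeff]; positivity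
  rw [← ofReal_norm, norm_mul, Complex.norm_exp, Complex.norm_of_nonneg h0, gaussian, gaussian,
    ← ENNReal.ofReal_mul (by positivity), ← ENNReal.ofReal_mul (by positivity), kernelCoeff]
  congr 1
  rw [mul_assoc, mul_assoc, ← Real.exp_add, ← Real.exp_add, inner_smul_left,
    @norm_sub_sq ℂ _ _ _ _ w z]
  congr 2
  simp only [Complex.conj_ofReal, Complex.re_ofReal_mul, RCLike.re_to_complex]
  ring

/-- The factor (1 + |w|)^{-m} in `kernelCoeff` compensates |z|^m near w, so the kernels have
Fock–Sobolev norms bounded uniformly in w. -/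
theorem weight_mul_gaussian_le (m : ℕ) {b : ℝ} (hb : 0 < b) (w z : Cn n) :
    ENNReal.ofReal (‖z‖ ^ (m : ℝ)) *
      (ENNReal.ofReal ((1 + ‖w‖) ^ (-(m : ℝ))) * gaussian b (w - z)) ≤
      ENNReal.ofReal (Real.exp ((m : ℝ) ^ 2 / (2 * b))) * gaussian (b / 2) (w - z) := by
  rw [gaussian_sub_comm b, gaussian_sub_comm (b / 2), gaussian, gaussian,
    ← ENNReal.ofReal_mul (by positivity), ← ENNReal.ofReal_mul (by positivity),
    ← ENNReal.ofReal_mul (by positivity)]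
  refine ENNReal.ofReal_le_ofReal ?_
  have h := weight_mul_exp_le (Nat.cast_nonneg m) hb z w
  have h1 : ‖z‖ ^ (m : ℝ) ≤ (1 + ‖z‖) ^ (m : ℝ) := by
    gcongr
    linarith
  have hw : 0 < (1 + ‖w‖) ^ (m : ℝ) := by positivity
  rw [Real.rpow_neg (by positivity)]
  calc ‖z‖ ^ (m : ℝ) * (((1 + ‖w‖) ^ (m : ℝ))⁻¹ * Real.exp (-b * ‖z - w‖ ^ 2))
      ≤ (1 + ‖z‖) ^ (m : ℝ) * (((1 + ‖w‖) ^ (m : ℝ))⁻¹ * Real.exp (-b * ‖z - w‖ ^ 2)) := by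
        gcongr
    _ = ((1 + ‖w‖) ^ (m : ℝ))⁻¹ * ((1 + ‖z‖) ^ (m : ℝ) * Real.exp (-b * ‖z - w‖ ^ 2)) := by ring
    _ ≤ ((1 + ‖w‖) ^ (m : ℝ))⁻¹ * (Real.exp ((m : ℝ) ^ 2 / (2 * b)) * (1 + ‖w‖) ^ (m : ℝ) *
          Real.exp (-(b / 2) * ‖z - w‖ ^ 2)) := by gcongr
    _ = _ := by field_simp

/-- A signed combination of normalised kernels at the first `N` points of a sequence. -/
noncomputable def testFunction (m : ℕ) (α : ℝ) (z : ℕ → Cn n) (c : ℕ → ℝ≥0) (N : ℕ)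
    (ε : Fin N → ℤˣ) : Cn n → ℂ :=
  expSum (fun k : Fin N => (α : ℂ) • z k)
    fun k => ((ε k : ℤ) : ℂ) * ((c k : ℂ) * (kernelCoeff m α (z k) : ℂ))

theorem testFunction_apply (m : ℕ) (α : ℝ) (z : ℕ → Cn n) (c : ℕ → ℝ≥0) (N : ℕ)
    (ε : Fin N → ℤˣ) (w : Cn n) :
    testFunction m α z c N ε w = ∑ k : Fin N, ((ε k : ℤ) : ℂ) * ((c k : ℂ) *
      ((kernelCoeff m α (z k) : ℂ) * Complex.exp (inner ℂ ((α : ℂ) • z k) w))) := by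
  simp only [testFunction, expSum, mul_assoc]

theorem enorm_testFunction_mul_gaussian_le (m : ℕ) (α : ℝ) (z : ℕ → Cn n) (c : ℕ → ℝ≥0) (N : ℕ)
    (ε : Fin N → ℤˣ) (w : Cn n) :
    ‖testFunction m α z c N ε w‖ₑ * gaussian (α / 2) w ≤
      ∑ k ∈ Finset.range N, c k *
        (ENNReal.ofReal ((1 + ‖z k‖) ^ (-(m : ℝ))) * gaussian (α / 2) (z k - w)) := by
  rw [testFunction_apply, ← Fin.sum_univ_eq_sum_range fun k => (c k : ℝ≥0∞) *
        (ENNReal.ofReal ((1 + ‖z k‖) ^ (-(m : ℝ))) * gaussian (α / 2) (z k - w))]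
  refine (mul_le_mul_left (enorm_sum_le _ _) _).trans_eq ?_
  rw [Finset.sum_mul]
  refine Finset.sum_congr rfl fun k _ => ?_
  have hn : ‖((ε k : ℤ) : ℂ)‖ₑ = 1 := by
    rcases Int.units_eq_one_or (ε k) with h | h <;> simp [h]
  have hc : ‖(c k : ℂ)‖ₑ = c k := by
    rw [← ofReal_norm, Complex.norm_of_nonneg (c k).coe_nonneg, ENNReal.ofReal_coe_nnreal]
  rw [enorm_mul, enorm_mul, hn, one_mul, hc, mul_assoc, enorm_kernel_mul_gaussian]

/-- The triangle inequality discards the signs and leaves a Gaussian superposition over the lattice;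
the constant depends neither on N nor on the signs. -/
theorem exists_fockSobolevNorm_testFunction_le (m : ℕ) {α p r : ℝ} (hα : 0 < α) (hp : 0 < p)
    (hr : 0 < r) :
    ∃ C : ℝ≥0∞, C ≠ ∞ ∧ ∀ z : ℕ → Cn n, IsHalfLattice r z → ∀ (c : ℕ → ℝ≥0) (N : ℕ)
      (ε : Fin N → ℤˣ),
      fockSobolevNorm m α p (testFunction m α z c N ε) ^ p ≤
        C * ∑ k ∈ Finset.range N, (c k : ℝ≥0∞) ^ p := by
  have hb : 0 < α / 2 := by positivity
  obtain ⟨M, hM, h⟩ := exists_lintegral_tsum_gaussian_rpow_le (n := n) (half_pos hb) (half_pos hr)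
    hp
  set D := ENNReal.ofReal (Real.exp ((m : ℝ) ^ 2 / (2 * (α / 2))))
  have hDp : D ^ p ≠ ∞ := ENNReal.rpow_ne_top_of_nonneg hp.le ENNReal.ofReal_ne_top
  refine ⟨ENNReal.ofReal (normConst n m α p) * (D ^ p * M), ENNReal.mul_ne_top
    ENNReal.ofReal_ne_top (ENNReal.mul_ne_top hDp hM), fun z hz c N ε => ?_⟩
  set c' : ℕ → ℝ≥0∞ := fun k => if k ∈ Finset.range N then c k else 0
  have hc' : ∑' k, c' k ^ p = ∑ k ∈ Finset.range N, (c k : ℝ≥0∞) ^ p := by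
    rw [tsum_eq_sum (s := Finset.range N)]
    · exact Finset.sum_congr rfl fun k hk => by simp only [c', if_pos hk]
    · intro k hk
      simp only [c', if_neg hk, ENNReal.zero_rpow_of_pos hp]
  have hsum : ∀ w, ∑' k, gaussian (α / 2 / 2) (z k - w) * c' k =
      ∑ k ∈ Finset.range N, gaussian (α / 2 / 2) (z k - w) * c k := by
    intro w
    rw [tsum_eq_sum (s := Finset.range N)]
    · exact Finset.sum_congr rfl fun k hk => by simp only [c', if_pos hk]
    · intro k hk
      simp only [c', if_neg hk, mul_zero]
  rw [fockSobolevNorm_rpow m α hp, mul_assoc, ← hc', mul_assoc]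
  gcongr
  calc ∫⁻ w : Cn n, ENNReal.ofReal (‖w‖ ^ ((m : ℝ) * p)) *
        ‖testFunction m α z c N ε w‖ₑ ^ p * gaussian (α * p / 2) w
      ≤ ∫⁻ w : Cn n, D ^ p * (∑' k, gaussian (α / 2 / 2) (z k - w) * c' k) ^ p := by
        refine lintegral_mono fun w => ?_
        simp only
        have h1 : α * p / 2 = α / 2 * p := by ring
        rw [Real.rpow_mul (norm_nonneg w), ← ENNReal.ofReal_rpow_of_nonneg (by positivity) hp.le,
          h1, ← gaussian_rpow, ← ENNReal.mul_rpow_of_nonneg _ _ hp.le,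
          ← ENNReal.mul_rpow_of_nonneg _ _ hp.le, ← ENNReal.mul_rpow_of_nonneg _ _ hp.le]
        refine ENNReal.rpow_le_rpow ?_ hp.le
        rw [hsum, mul_assoc]
        refine (mul_le_mul_right (enorm_testFunction_mul_gaussian_le m α z c N ε w) _).trans ?_
        rw [Finset.mul_sum, Finset.mul_sum]
        refine Finset.sum_le_sum fun k _ => ?_
        rw [mul_left_comm, mul_comm _ (c k : ℝ≥0∞), mul_left_comm D]
        exact mul_le_mul_right (weight_mul_gaussian_le m hb _ _) _
    _ = D ^ p * ∫⁻ w : Cn n, (∑' k, gaussian (α / 2 / 2) (z k - w) * c' k) ^ p :=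
        lintegral_const_mul' _ _ hDp
    _ ≤ D ^ p * (M * ∑' k, c' k ^ p) := by
        gcongr
        exact h z hz.disjoint c'
    _ = _ := by ring

/-- Pointwise lower bound for the sign average of the test functions. -/
theorem sum_indicator_le_sum_testFunction (m : ℕ) {α q r : ℝ} (hq : 0 < q) {z : ℕ → Cn n}
    {M : ℝ≥0∞} (hM : ∀ w, ∑' k, gaussian 1 (z k - w) ≤ M) (c : ℕ → ℝ≥0) (N : ℕ) (w : Cn n) :
    (Fintype.card (Fin N → ℤˣ) : ℝ≥0∞) * ∑ k ∈ Finset.range N,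
      (Metric.ball (z k) r).indicator (fun w => ((c k : ℝ≥0∞) *
        (ENNReal.ofReal ((1 + ‖z k‖) ^ (-(m : ℝ))) * gaussian (α / 2) (z k - w))) ^ q) w ≤
      ENNReal.ofReal (Real.exp (r ^ 2)) * M * (2 * ∑ ε : Fin N → ℤˣ,
        ‖testFunction m α z c N ε w‖ₑ ^ q * gaussian (α * q / 2) w) := by
  set E := ENNReal.ofReal (Real.exp (r ^ 2))
  set Y := 2 * ∑ ε : Fin N → ℤˣ, ‖testFunction m α z c N ε w‖ₑ ^ q * gaussian (α * q / 2) w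
  rw [Finset.mul_sum]
  -- Each term is dominated by the sign average. On D(z_k, r) the factor E * gaussian 1 (z k - w) is
  -- at least 1, so the Gaussian sum bound M controls how many of these balls overlap at w.
  have hterm : ∀ k ∈ Finset.range N, (Fintype.card (Fin N → ℤˣ) : ℝ≥0∞) *
      (Metric.ball (z k) r).indicator (fun w => ((c k : ℝ≥0∞) *
        (ENNReal.ofReal ((1 + ‖z k‖) ^ (-(m : ℝ))) * gaussian (α / 2) (z k - w))) ^ q) w ≤
      E * gaussian 1 (z k - w) * Y := by
    intro k hk
    by_cases hw : w ∈ Metric.ball (z k) r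
    · rw [Set.indicator_of_mem hw]
      have h1 : 1 ≤ E * gaussian 1 (z k - w) := by
        rw [gaussian, ← ENNReal.ofReal_mul (Real.exp_pos _).le, ← Real.exp_add,
          ← ENNReal.ofReal_one]
        refine ENNReal.ofReal_le_ofReal (Real.one_le_exp ?_)
        have hw : ‖z k - w‖ < r := by
          rw [← dist_eq_norm]; exact Metric.mem_ball'.1 hw
        have : ‖z k - w‖ ^ 2 ≤ r ^ 2 := by gcongr
        linarith
      refine le_trans ?_ (le_mul_of_one_le_left (zero_le) h1)
      have hsgn := card_mul_enorm_rpow_le (fun i : Fin N => (c i : ℂ) *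
        ((kernelCoeff m α (z i) : ℂ) * Complex.exp (inner ℂ ((α : ℂ) • z i) w)))
        ⟨k, Finset.mem_range.1 hk⟩ hq
      simp only [← testFunction_apply] at hsgn
      have h2 := mul_le_mul_left hsgn (gaussian (α / 2) w ^ q)
      rw [mul_assoc, ← ENNReal.mul_rpow_of_nonneg _ _ hq.le, enorm_mul, mul_assoc,
        enorm_kernel_mul_gaussian, gaussian_rpow] at h2
      have hc : ‖(c k : ℂ)‖ₑ = c k := by
        rw [← ofReal_norm, Complex.norm_of_nonneg (c k).coe_nonneg, ENNReal.ofReal_coe_nnreal]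
      rw [hc] at h2
      refine h2.trans_eq ?_
      have h3 : α * q / 2 = α / 2 * q := by ring
      simp only [Y]
      rw [mul_assoc, Finset.sum_mul, h3]
    · rw [Set.indicator_of_notMem hw, mul_zero]
      exact zero_le
  refine (Finset.sum_le_sum hterm).trans ?_
  rw [← Finset.sum_mul, ← Finset.mul_sum]
  gcongr
  exact (ENNReal.sum_le_tsum _).trans (hM w)

/-- Testing the embedding on random sums of kernels. -/
theorem exists_sum_averaging_le (m : ℕ) {α p q r : ℝ} (hα : 0 < α) (hq : 0 < q) (hp : 0 < p)
    (hr : 0 < r) :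
    ∃ C : ℝ≥0∞, C ≠ ∞ ∧ ∀ z : ℕ → Cn n, IsHalfLattice r z → ∀ (μ : Measure (Cn n)) (K : ℝ≥0∞),
      (∀ f : Cn n → ℂ, MemFockSobolev m α p f →
        carlesonIntegral α q μ f ≤ K * fockSobolevNorm m α p f ^ q) →
      ∀ (c : ℕ → ℝ≥0) (N : ℕ),
        ∑ k ∈ Finset.range N, (c k : ℝ≥0∞) ^ q * averaging (m * q) r μ (z k) ≤
          C * K * (∑ k ∈ Finset.range N, (c k : ℝ≥0∞) ^ p) ^ (q / p) := by
  obtain ⟨M, hM, hgs⟩ := exists_tsum_gaussian_le (n := n) one_pos (half_pos hr)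
  obtain ⟨T, hT, htest⟩ := exists_fockSobolevNorm_testFunction_le (n := n) m hα hp hr
  set E := ENNReal.ofReal (Real.exp (r ^ 2))
  set G := ENNReal.ofReal (Real.exp (-(α * q / 2) * r ^ 2))
  have hG : G ≠ 0 := by simp [G, Real.exp_pos]
  have hqp : 0 ≤ q / p := by positivity
  refine ⟨G⁻¹ * (E * M * 2 * T ^ (q / p)), ENNReal.mul_ne_top (ENNReal.inv_ne_top.2 hG)
    (ENNReal.mul_ne_top (ENNReal.mul_ne_top (ENNReal.mul_ne_top ENNReal.ofReal_ne_top hM)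
      ENNReal.ofNat_ne_top) (ENNReal.rpow_ne_top_of_nonneg hqp hT)), fun z hz μ K hK c N => ?_⟩
  set cN : ℝ≥0∞ := (Fintype.card (Fin N → ℤˣ) : ℝ≥0∞)
  have hcN : cN ≠ 0 := by simp [cN]
  have hcN' : cN ≠ ∞ := ENNReal.natCast_ne_top _
  set X : ℕ → Cn n → ℝ≥0∞ := fun k w => ((c k : ℝ≥0∞) *
        (ENNReal.ofReal ((1 + ‖z k‖) ^ (-(m : ℝ))) * gaussian (α / 2) (z k - w))) ^ q
  have hX : ∀ k, Measurable (X k) := fun k =>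
    (((measurable_gaussian _).comp (by fun_prop)).const_mul _ |>.const_mul _).pow_const q
  set P := ∑ k ∈ Finset.range N, (c k : ℝ≥0∞) ^ p
  have hnorm : ∀ ε : Fin N → ℤˣ, carlesonIntegral α q μ (testFunction m α z c N ε) ≤
      K * (T ^ (q / p) * P ^ (q / p)) := by
    intro ε
    refine (hK _ (memFockSobolev_expSum m hα hp _ _)).trans ?_
    gcongr
    rw [← ENNReal.mul_rpow_of_nonneg _ _ hqp]
    have h1 := ENNReal.rpow_le_rpow (htest z hz c N ε) hqp
    rwa [← ENNReal.rpow_mul, mul_div_cancel₀ _ hp.ne'] at h1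
  -- On D(z_k, r) the bump is bounded below, with q-th power at least G.
  have hlow : ∀ k, G * ((c k : ℝ≥0∞) ^ q * averaging (m * q) r μ (z k)) ≤
      ∫⁻ w in Metric.ball (z k) r, X k w ∂μ := by
    intro k
    calc G * ((c k : ℝ≥0∞) ^ q * averaging (m * q) r μ (z k))
        = ∫⁻ w in Metric.ball (z k) r, G * ((c k : ℝ≥0∞) ^ q *
            ENNReal.ofReal ((1 + ‖z k‖) ^ (-((m : ℝ) * q)))) ∂μ := by
          rw [setLIntegral_const, averaging_eq]; ring
      _ ≤ _ := by
          refine setLIntegral_mono' measurableSet_ball fun w hw => ?_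
          have hw : ‖z k - w‖ < r := by
            rw [← dist_eq_norm]; exact Metric.mem_ball'.1 hw
          simp only [X]
          rw [ENNReal.mul_rpow_of_nonneg _ _ hq.le, ENNReal.mul_rpow_of_nonneg _ _ hq.le,
            gaussian_rpow, ENNReal.ofReal_rpow_of_nonneg (by positivity) hq.le,
            ← Real.rpow_mul (by positivity), neg_mul, mul_comm G, mul_assoc]
          gcongr
          refine ENNReal.ofReal_le_ofReal (Real.exp_le_exp.2 ?_)
          have h1 : ‖z k - w‖ ^ 2 ≤ r ^ 2 := by gcongr
          have h2 : 0 < α * q / 2 := by positivity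
          have h3 : α / 2 * q = α * q / 2 := by ring
          rw [h3]
          nlinarith
  have hmain : cN * (G * ∑ k ∈ Finset.range N, (c k : ℝ≥0∞) ^ q *
      averaging (m * q) r μ (z k)) ≤
      cN * (E * M * 2 * (K * (T ^ (q / p) * P ^ (q / p)))) := by
    calc cN * (G * ∑ k ∈ Finset.range N, (c k : ℝ≥0∞) ^ q * averaging (m * q) r μ (z k))
        ≤ cN * ∑ k ∈ Finset.range N, ∫⁻ w, (Metric.ball (z k) r).indicator (X k) w ∂μ := by
          rw [Finset.mul_sum]
          gcongr with k _
          rw [lintegral_indicator measurableSet_ball]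
          exact hlow k
      _ = ∫⁻ w, cN * ∑ k ∈ Finset.range N, (Metric.ball (z k) r).indicator (X k) w ∂μ := by
          rw [lintegral_const_mul' _ _ hcN', lintegral_finsetSum]
          exact fun k _ => (hX k).indicator measurableSet_ball
      _ ≤ ∫⁻ w, E * M * (2 * ∑ ε : Fin N → ℤˣ,
            ‖testFunction m α z c N ε w‖ₑ ^ q * gaussian (α * q / 2) w) ∂μ :=
          lintegral_mono fun w =>
            sum_indicator_le_sum_testFunction m hq (hgs z hz.disjoint) c N w
      _ = E * M * (2 * ∑ ε : Fin N → ℤˣ,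
            carlesonIntegral α q μ (testFunction m α z c N ε)) := by
          rw [lintegral_const_mul' _ _ (ENNReal.mul_ne_top ENNReal.ofReal_ne_top hM),
            lintegral_const_mul' _ _ ENNReal.ofNat_ne_top, lintegral_finsetSum]
          · rfl
          · intro ε _
            exact ((differentiable_expSum _ _).continuous.measurable.enorm.pow_const q).mul
              (measurable_gaussian _)
      _ ≤ E * M * (2 * ∑ _ε : Fin N → ℤˣ, K * (T ^ (q / p) * P ^ (q / p))) := by
          gcongr with ε _
          exact hnorm ε
      _ = _ := by
          rw [Finset.sum_const, Finset.card_univ, nsmul_eq_mul]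
          ring
  rw [ENNReal.mul_le_mul_iff_right hcN hcN',
    ENNReal.mul_le_iff_le_inv hG ENNReal.ofReal_ne_top] at hmain
  refine hmain.trans_eq ?_
  ring

/-! ### Sequence-space duality. -/

/-- Duality between `ℓ^{p/q}` and `ℓ^{p/(p-q)}` for nonnegative sequences. -/
theorem seqNorm_le_of_sum_le {p q : ℝ} (hq : 0 < q) (hqp : q < p) {a : ℕ → ℝ≥0∞} {D : ℝ≥0∞}
    (h : ∀ (c : ℕ → ℝ≥0) (N : ℕ), ∑ k ∈ Finset.range N, (c k : ℝ≥0∞) ^ q * a k ≤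
      D * (∑ k ∈ Finset.range N, (c k : ℝ≥0∞) ^ p) ^ (q / p)) :
    seqNorm (p / (p - q)) a ≤ D := by
  have hp : 0 < p := hq.trans hqp
  have hpq : 0 < p - q := sub_pos.2 hqp
  set σ := p / (p - q)
  have hσ : 0 < σ := by positivity
  by_cases hD : D = ∞
  · rw [hD]; exact le_top
  -- Testing on unit sequences gives a k ≤ D < ∞, which allows powers of a k as finite coefficients.
  have ha : ∀ k, a k ≠ ∞ := by
    intro k
    refine ne_top_of_le_ne_top hD ?_
    have h1 := h (Pi.single k 1) (k + 1)
    rw [Finset.sum_range_succ, Finset.sum_range_succ, Finset.sum_eq_zero, Finset.sum_eq_zero] at h1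
    · simpa using h1
    · intro i hi
      rw [Pi.single_eq_of_ne (Finset.mem_range.1 hi).ne, ENNReal.coe_zero,
        ENNReal.zero_rpow_of_pos hp]
    · intro i hi
      rw [Pi.single_eq_of_ne (Finset.mem_range.1 hi).ne, ENNReal.coe_zero,
        ENNReal.zero_rpow_of_pos hq, zero_mul]
  have hfin : ∀ N, ∑ k ∈ Finset.range N, a k ^ σ ≤ D ^ σ := by
    intro N
    set T := ∑ k ∈ Finset.range N, a k ^ σ
    have hT : T ≠ ∞ := ENNReal.sum_ne_top.2 fun k _ =>
      ENNReal.rpow_ne_top_of_nonneg hσ.le (ha k)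
    by_cases hT0 : T = 0
    · rw [hT0]; exact zero_le
    -- The extremal choice c_k = a_k^{1/(p-q)} makes both c_k^q a_k and c_k^p equal to a_k^σ; the
    -- hypothesis becomes T ≤ D T^{q/p}, and dividing leaves T^{1/σ} ≤ D.
    have hc : ∀ k, (((a k).toNNReal ^ (1 / (p - q)) : ℝ≥0) : ℝ≥0∞) = a k ^ (1 / (p - q)) := by
      intro k
      rw [ENNReal.coe_rpow_of_nonneg _ (by positivity), ENNReal.coe_toNNReal (ha k)]
    have h1 := h (fun k => (a k).toNNReal ^ (1 / (p - q))) N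
    simp only [hc, ← ENNReal.rpow_mul] at h1
    have h2 : ∀ k, a k ^ (1 / (p - q) * q) * a k = a k ^ σ := by
      intro k
      conv_lhs => rw [← ENNReal.rpow_one (a k)]
      rw [← ENNReal.rpow_mul, one_mul, ← ENNReal.rpow_add_of_nonneg _ _ (by positivity) one_pos.le]
      congr 1
      simp only [σ]
      field_simp
      ring
    have h3 : 1 / (p - q) * p = σ := by simp only [σ]; ring
    simp only [h2, h3] at h1
    change T ≤ D * T ^ (q / p) at h1
    have h4 : T = T ^ (1 / σ) * T ^ (q / p) := by
      rw [← ENNReal.rpow_add_of_nonneg _ _ (by positivity) (by positivity)]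
      have : 1 / σ + q / p = 1 := by
        simp only [σ]
        field_simp
        ring
      rw [this, ENNReal.rpow_one]
    have hTq : T ^ (q / p) ≠ 0 := by
      simp only [ne_eq, ENNReal.rpow_eq_zero_iff, not_or, not_and]
      exact ⟨fun h => absurd h hT0, fun h => absurd h hT⟩
    have hTq' : T ^ (q / p) ≠ ∞ := ENNReal.rpow_ne_top_of_nonneg (by positivity) hT
    have h5 := h4.symm.trans_le h1
    rwa [ENNReal.mul_le_mul_iff_left hTq hTq', one_div, ENNReal.rpow_inv_le_iff hσ] at h5
  rw [seqNorm, one_div, ENNReal.rpow_inv_le_iff hσ]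
  exact ENNReal.tsum_le_of_sum_range_le hfin

/-! ### Vanishing Carleson measures -/

/-- Dominated convergence: D(w, r) lies in D(0, k) once k ≥ |w| + r, so the restricted averages are
eventually zero at each w. -/
theorem tendsto_lintegral_averaging_restrict_compl {s r σ : ℝ} (hσ : 0 < σ) {μ : Measure (Cn n)}
    (h : ∫⁻ w, averaging s r μ w ^ σ ≠ ∞) :
    Tendsto (fun k : ℕ => ∫⁻ w, averaging s r (μ.restrict (Metric.ball 0 (k : ℝ))ᶜ) w ^ σ)
      atTop (𝓝 0) := by
  have hle : ∀ (k : ℕ) (w : Cn n),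
      averaging s r (μ.restrict (Metric.ball 0 (k : ℝ))ᶜ) w ≤ averaging s r μ w := by
    intro k w
    exact ENNReal.div_le_div_right (Measure.restrict_le_self _) _
  have hlim := tendsto_lintegral_of_dominated_convergence (μ := (volume : Measure (Cn n)))
    (F := fun (k : ℕ) w => averaging s r (μ.restrict (Metric.ball 0 (k : ℝ))ᶜ) w ^ σ)
    (f := fun _ => 0) (fun w => averaging s r μ w ^ σ)
    (fun k => (measurable_averaging s r _).pow_const σ)
    (fun k => ae_of_all _ fun w => ENNReal.rpow_le_rpow (hle k w) hσ.le) h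
    (ae_of_all _ fun w => ?_)
  · simpa using hlim
  · obtain ⟨K, hK⟩ := exists_nat_ge (‖w‖ + r)
    refine tendsto_const_nhds.congr' ?_
    filter_upwards [eventually_ge_atTop K] with k hk
    have hk' : (K : ℝ) ≤ k := by exact_mod_cast hk
    have hsub : Metric.ball w r ∩ (Metric.ball 0 (k : ℝ))ᶜ = ∅ := by
      rw [← Set.sdiff_eq, Set.sdiff_eq_empty]
      refine Metric.ball_subset_ball' ?_
      rw [dist_zero_right]
      linarith
    rw [averaging, Measure.restrict_apply measurableSet_ball, hsub, measure_empty,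
      ENNReal.zero_div, ENNReal.zero_rpow_of_pos hσ]

theorem gaussian_le_one {b : ℝ} (hb : 0 ≤ b) (z : Cn n) : gaussian b z ≤ 1 := by
  rw [gaussian, ← ENNReal.ofReal_one]
  refine ENNReal.ofReal_le_ofReal (Real.exp_le_one_iff.2 ?_)
  have : 0 ≤ b * ‖z‖ ^ 2 := by positivity
  linarith

/-- Split μ at a large ball. Outside it the embedding bound for the restricted measure is small
uniformly in j; inside, f_j → 0 uniformly and the ball has finite mass. -/
theorem isVanishingFockCarleson_of_averaging (hn : 0 < n) (m : ℕ) {α p q r : ℝ} (hα : 0 < α)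
    (hq : 0 < q) (hqp : q < p) (hr : 0 < r) {μ : Measure (Cn n)}
    (hμ : ∫⁻ w, averaging (m * q) r μ w ^ (p / (p - q)) ≠ ∞) :
    IsVanishingFockCarleson m α p q μ := by
  intro f hf ⟨M, hM⟩ hunif
  have hσ : 0 < p / (p - q) := (holderConjugate_div hq hqp).symm.pos
  set σ := p / (p - q)
  have hloc := isLocallyFiniteMeasure_of_lintegral_averaging hσ hr hμ
  obtain ⟨C, hC, hcar⟩ := exists_carlesonIntegral_le hn m hα hq hqp hr
  have htail : Tendsto (fun k : ℕ => C * (∫⁻ w, averaging (m * q) r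
      (μ.restrict (Metric.ball 0 (k : ℝ))ᶜ) w ^ σ) ^ (1 / σ) * (M : ℝ≥0∞) ^ q) atTop (𝓝 0) := by
    have h1 := (tendsto_lintegral_averaging_restrict_compl hσ hμ).ennrpow_const (1 / σ)
    rw [ENNReal.zero_rpow_of_pos (by positivity)] at h1
    have h2 := ENNReal.Tendsto.mul_const (ENNReal.Tendsto.const_mul h1 (Or.inr hC))
      (Or.inr (ENNReal.rpow_ne_top_of_nonneg hq.le (ENNReal.coe_ne_top (r := M))))
    simpa using h2
  rw [ENNReal.tendsto_nhds_zero] at htail ⊢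
  intro ε hε
  have hε2 : 0 < ε / 2 := ENNReal.half_pos hε.ne'
  obtain ⟨k, hk⟩ := (htail (ε / 2) hε2).exists
  set V := μ (Metric.ball 0 (k : ℝ))
  have hV : V ≠ ∞ := measure_ball_lt_top.ne
  have hδ : ∃ δ : ℝ, 0 < δ ∧ ENNReal.ofReal δ ^ q * V ≤ ε / 2 := by
    have h1 : Tendsto (fun δ : ℝ => ENNReal.ofReal δ ^ q * V) (𝓝[>] 0) (𝓝 0) := by
      have h2 : Tendsto (fun δ : ℝ => ENNReal.ofReal δ ^ q) (𝓝[>] 0) (𝓝 0) := by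
        have h3 := (ENNReal.tendsto_ofReal (tendsto_id (x := 𝓝 (0 : ℝ)))).ennrpow_const q
        rw [ENNReal.ofReal_zero, ENNReal.zero_rpow_of_pos hq] at h3
        exact h3.mono_left nhdsWithin_le_nhds
      simpa using ENNReal.Tendsto.mul_const h2 (Or.inr hV)
    obtain ⟨δ, h4, h5⟩ := ((ENNReal.tendsto_nhds_zero.1 h1 _ hε2).and
      self_mem_nhdsWithin).exists
    exact ⟨δ, h5, h4⟩
  obtain ⟨δ, hδ0, hδ⟩ := hδ
  have hu := Metric.tendstoUniformlyOn_iff.1 (hunif _ (isCompact_closedBall 0 (k : ℝ))) δ hδ0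
  filter_upwards [hu] with j hj
  have hsplit : carlesonIntegral α q μ (f j) =
      (∫⁻ z in Metric.ball 0 (k : ℝ), ‖f j z‖ₑ ^ q * gaussian (α * q / 2) z ∂μ) +
        carlesonIntegral α q (μ.restrict (Metric.ball 0 (k : ℝ))ᶜ) (f j) :=
    (lintegral_add_compl _ measurableSet_ball).symm
  rw [hsplit, ← ENNReal.add_halves ε]
  refine add_le_add ?_ ?_
  · refine le_trans ?_ hδ
    rw [← setLIntegral_const]
    refine setLIntegral_mono' measurableSet_ball fun z hz => ?_
    have h1 := hj z (Metric.ball_subset_closedBall hz)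
    rw [dist_zero_left] at h1
    calc ‖f j z‖ₑ ^ q * gaussian (α * q / 2) z ≤ ENNReal.ofReal δ ^ q * 1 := by
          gcongr
          · rw [← ofReal_norm]
            exact ENNReal.ofReal_le_ofReal h1.le
          · exact gaussian_le_one (by positivity) z
      _ = _ := mul_one _
  · refine (hcar _ ?_ (f j) (hf j).1).trans (le_trans ?_ hk)
    · refine ne_top_of_le_ne_top hμ (lintegral_mono fun w => ENNReal.rpow_le_rpow ?_ hσ.le)
      exact ENNReal.div_le_div_right (Measure.restrict_le_self _) _
    · gcongr
      exact hM j

theorem exists_enorm_le_mul_fockSobolevNorm (hn : 0 < n) (m : ℕ) {α p : ℝ} (hα : 0 < α)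
    (hp : 0 < p) (R : ℝ) :
    ∃ C : ℝ≥0∞, C ≠ ∞ ∧ ∀ f : Cn n → ℂ, Differentiable ℂ f → ∀ z, ‖z‖ ≤ R →
      ‖f z‖ₑ ≤ C * fockSobolevNorm m α p f := by
  obtain ⟨C, hC, h⟩ := exists_enorm_rpow_mul_gaussian_le hn m hα hp
  set G := ENNReal.ofReal (Real.exp (-(α * p / 2) * R ^ 2))
  have hG : G ≠ 0 := by simp [G, Real.exp_pos]
  refine ⟨(G⁻¹ * C) ^ p⁻¹, ENNReal.rpow_ne_top_of_nonneg (by positivity)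
    (ENNReal.mul_ne_top (ENNReal.inv_ne_top.2 hG) hC), fun f hf z hz => ?_⟩
  have h1 : G * ‖f z‖ₑ ^ p ≤ C * fockSobolevNorm m α p f ^ p := by
    refine le_trans ?_ (h f hf z)
    rw [mul_comm]
    gcongr
    refine ENNReal.ofReal_le_ofReal (Real.exp_le_exp.2 ?_)
    have : ‖z‖ ^ 2 ≤ R ^ 2 := by gcongr
    have h2 : 0 < α * p / 2 := by positivity
    nlinarith
  rw [ENNReal.mul_le_iff_le_inv hG ENNReal.ofReal_ne_top, ← mul_assoc] at h1
  have h2 := ENNReal.rpow_le_rpow h1 (inv_nonneg.2 hp.le)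
  rwa [ENNReal.mul_rpow_of_nonneg _ _ (inv_nonneg.2 hp.le), ENNReal.rpow_rpow_inv hp.ne',
    ENNReal.rpow_rpow_inv hp.ne'] at h2

/-- If boundedness fails, there are f_j with integral above ((j+1)‖f_j‖)^q. Dividing f_j by
(j+1)‖f_j‖ makes the norms tend to 0, hence the functions tend to 0 locally uniformly, yet the
integrals stay at least 1. -/
theorem IsVanishingFockCarleson.isFockCarleson (hn : 0 < n) {m : ℕ} {α p q : ℝ} (hα : 0 < α)
    (hp : 0 < p) (hq : 0 < q) {μ : Measure (Cn n)} (h : IsVanishingFockCarleson m α p q μ) :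
    IsFockCarleson m α p q μ := by
  by_contra hcon
  rw [IsFockCarleson] at hcon
  push Not at hcon
  choose f hf hlt using fun j : ℕ => hcon (((j : ℝ≥0) + 1) ^ q)
  have hj0 : ∀ j : ℕ, (j : ℝ≥0∞) + 1 ≠ 0 := fun j => by simp
  have hjt : ∀ j : ℕ, (j : ℝ≥0∞) + 1 ≠ ∞ := fun j => by simp
  have hlt' : ∀ j : ℕ, (((j : ℝ≥0∞) + 1) * fockSobolevNorm m α p (f j)) ^ q <
      carlesonIntegral α q μ (f j) := by
    intro j
    have := hlt j
    rw [ENNReal.coe_rpow_of_nonneg _ hq.le, ← ENNReal.mul_rpow_of_nonneg _ _ hq.le] at this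
    simpa using this
  have htop : ∀ j, fockSobolevNorm m α p (f j) ≠ ∞ := by
    intro j hj
    have := hlt' j
    rw [hj, ENNReal.mul_top (hj0 j), ENNReal.top_rpow_of_pos hq] at this
    exact not_top_lt this
  -- Zero norm forces f_j = 0 by point evaluation, and then the integral could not be strictly
  -- positive.
  have hzero : ∀ j, fockSobolevNorm m α p (f j) ≠ 0 := by
    intro j hj
    have hf0 : ∀ z, ‖f j z‖ₑ = 0 := by
      intro z
      obtain ⟨C, _, hC⟩ := exists_enorm_le_mul_fockSobolevNorm hn m hα hp ‖z‖
      have := hC (f j) (hf j).1 z le_rfl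
      rw [hj, mul_zero] at this
      exact le_antisymm this zero_le
    have := hlt' j
    simp only [carlesonIntegral, hf0, ENNReal.zero_rpow_of_pos hq, zero_mul,
      lintegral_zero] at this
    exact not_lt_zero this
  set c : ℕ → ℂ := fun j => ((((j : ℝ) + 1) * (fockSobolevNorm m α p (f j)).toReal)⁻¹ : ℝ)
  have hc : ∀ j, ‖c j‖ₑ = (((j : ℝ≥0∞) + 1) * fockSobolevNorm m α p (f j))⁻¹ := by
    intro j
    have hpos : 0 < (fockSobolevNorm m α p (f j)).toReal :=
      ENNReal.toReal_pos (hzero j) (htop j)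
    rw [← ofReal_norm, Complex.norm_of_nonneg (by positivity),
      ENNReal.ofReal_inv_of_pos (by positivity), ENNReal.ofReal_mul (by positivity),
      ENNReal.ofReal_toReal (htop j)]
    congr 2
    rw [ENNReal.ofReal_add (by positivity) zero_le_one]
    simp
  have hnorm : ∀ j, fockSobolevNorm m α p (c j • f j) = ((j : ℝ≥0∞) + 1)⁻¹ := by
    intro j
    rw [fockSobolevNorm_const_smul m α hp, hc, ENNReal.mul_inv (Or.inl (hj0 j)) (Or.inl (hjt j)),
      mul_assoc, ENNReal.inv_mul_cancel (hzero j) (htop j), mul_one]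
  have hinv : Tendsto (fun j : ℕ => ((j : ℝ≥0∞) + 1)⁻¹) atTop (𝓝 0) := by
    have := (tendsto_add_atTop_iff_nat 1).2 ENNReal.tendsto_inv_nat_nhds_zero
    simpa using this
  have hlim := h (fun j => c j • f j) (fun j => (hf j).const_smul hα hp (c j)) ⟨1, fun j => ?_⟩
    fun K hK => ?_
  · obtain ⟨j, hj⟩ := (hlim.eventually_lt_const (zero_lt_one' ℝ≥0∞)).exists
    have hX0 : ((j : ℝ≥0∞) + 1) * fockSobolevNorm m α p (f j) ≠ 0 :=
      mul_ne_zero (hj0 j) (hzero j)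
    have hXt : ((j : ℝ≥0∞) + 1) * fockSobolevNorm m α p (f j) ≠ ∞ :=
      ENNReal.mul_ne_top (hjt j) (htop j)
    rw [carlesonIntegral_const_smul α hq, hc] at hj
    refine absurd hj (not_lt.2 ?_)
    calc (1 : ℝ≥0∞) = (((j : ℝ≥0∞) + 1) * fockSobolevNorm m α p (f j))⁻¹ ^ q *
          (((j : ℝ≥0∞) + 1) * fockSobolevNorm m α p (f j)) ^ q := by
          rw [← ENNReal.mul_rpow_of_nonneg _ _ hq.le, ENNReal.inv_mul_cancel hX0 hXt,
            ENNReal.one_rpow]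
      _ ≤ _ := by
          gcongr
          exact (hlt' j).le
  · rw [hnorm, ENNReal.coe_one]
    exact ENNReal.inv_le_one.2 le_add_self
  · obtain ⟨R, hR⟩ := hK.isBounded.exists_norm_le
    obtain ⟨C, hC, hCf⟩ := exists_enorm_le_mul_fockSobolevNorm hn m hα hp R
    have hCinv : Tendsto (fun j : ℕ => C * ((j : ℝ≥0∞) + 1)⁻¹) atTop (𝓝 0) := by
      simpa using ENNReal.Tendsto.const_mul hinv (Or.inr hC)
    rw [Metric.tendstoUniformlyOn_iff]
    intro ε hε
    filter_upwards [hCinv.eventually_lt_const (ENNReal.ofReal_pos.2 hε)] with j hj z hz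
    have h1 := hCf _ ((hf j).const_smul hα hp (c j)).1 z (hR z hz)
    rw [hnorm, ← ofReal_norm] at h1
    rw [dist_zero_left]
    exact (ENNReal.ofReal_lt_ofReal_iff hε).1 (h1.trans_lt hj)

/-! ### The norm comparisons -/

theorem eLpNorm_ofReal {σ : ℝ} (hσ : 0 < σ) (f : Cn n → ℝ≥0∞) :
    eLpNorm f (ENNReal.ofReal σ) volume = (∫⁻ w, f w ^ σ) ^ (1 / σ) := by
  rw [eLpNorm_eq_lintegral_rpow_enorm_toReal (by simpa using hσ) ENNReal.ofReal_ne_top,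
    ENNReal.toReal_ofReal hσ.le]
  simp only [enorm_eq_self]

theorem eLpNorm_ofReal_lt_top_iff {σ : ℝ} (hσ : 0 < σ) (f : Cn n → ℝ≥0∞) :
    eLpNorm f (ENNReal.ofReal σ) volume < ∞ ↔ ∫⁻ w, f w ^ σ ≠ ∞ := by
  rw [eLpNorm_ofReal hσ, ENNReal.rpow_lt_top_iff_of_pos (by positivity), lt_top_iff_ne_top]

theorem rpow_one_div_le {σ : ℝ} (hσ : 0 < σ) {C x y : ℝ≥0∞} (h : x ≤ C * y) :
    x ^ (1 / σ) ≤ C ^ (1 / σ) * y ^ (1 / σ) := by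
  rw [← ENNReal.mul_rpow_of_nonneg _ _ (by positivity)]
  exact ENNReal.rpow_le_rpow h (by positivity)

theorem exists_nnreal_mul_le {X : Type*} {C : ℝ≥0∞} (hC : C ≠ ∞) {x y : X → ℝ≥0∞}
    (h : ∀ μ, x μ ≤ C * y μ) : ∃ D : ℝ≥0, ∀ μ, x μ ≤ D * y μ :=
  ⟨C.toNNReal, fun μ => by rw [ENNReal.coe_toNNReal hC]; exact h μ⟩

theorem exists_eLpNorm_berezin_le {α t s r σ : ℝ} (hα : 0 < α) (ht : 0 < t) (hs : 0 ≤ s)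
    (hr : 0 < r) (hσ : 1 < σ) :
    ∃ C : ℝ≥0, ∀ μ : Measure (Cn n), eLpNorm (berezin α t s μ) (ENNReal.ofReal σ) volume ≤
      C * eLpNorm (averaging s r μ) (ENNReal.ofReal σ) volume := by
  have hσ0 : 0 < σ := one_pos.trans hσ
  obtain ⟨C, hC, h⟩ := exists_lintegral_berezin_le (n := n) hα ht hs hr hσ
  simp only [eLpNorm_ofReal hσ0]
  exact exists_nnreal_mul_le (ENNReal.rpow_ne_top_of_nonneg (by positivity) hC)
    fun μ => rpow_one_div_le hσ0 (h μ)

theorem exists_eLpNorm_averaging_le_berezin {α t s r σ : ℝ} (hα : 0 < α) (ht : 0 < t)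
    (hs : 0 ≤ s) (hr : 0 < r) (hσ : 0 < σ) :
    ∃ C : ℝ≥0, ∀ μ : Measure (Cn n), eLpNorm (averaging s r μ) (ENNReal.ofReal σ) volume ≤
      C * eLpNorm (berezin α t s μ) (ENNReal.ofReal σ) volume := by
  set E := ENNReal.ofReal ((1 + r) ^ s * Real.exp (t * α / 2 * r ^ 2))
  have hE : E ^ σ ≠ ∞ := ENNReal.rpow_ne_top_of_nonneg hσ.le ENNReal.ofReal_ne_top
  simp only [eLpNorm_ofReal hσ]
  refine exists_nnreal_mul_le (C := (E ^ σ) ^ (1 / σ))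
    (ENNReal.rpow_ne_top_of_nonneg (by positivity) hE) fun μ => rpow_one_div_le hσ ?_
  rw [← lintegral_const_mul' _ _ hE]
  refine lintegral_mono fun w => ?_
  rw [← ENNReal.mul_rpow_of_nonneg _ _ hσ.le]
  exact ENNReal.rpow_le_rpow (averaging_le_berezin hα ht hs hr μ w) hσ.le

theorem exists_eLpNorm_averaging_le_seqNorm {s r r' σ : ℝ} (hs : 0 ≤ s) (hr' : 0 < r')
    (hσ : 0 < σ) {z : ℕ → Cn n} (hz : IsHalfLattice r' z) :
    ∃ C : ℝ≥0, ∀ μ : Measure (Cn n), eLpNorm (averaging s r μ) (ENNReal.ofReal σ) volume ≤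
      C * seqNorm σ fun k => averaging s r' μ (z k) := by
  obtain ⟨C, hC, h⟩ := exists_lintegral_averaging_le (n := n) (r := r) hs hr' hσ
  simp only [eLpNorm_ofReal hσ]
  exact exists_nnreal_mul_le (ENNReal.rpow_ne_top_of_nonneg (by positivity) hC)
    fun μ => rpow_one_div_le hσ (h z hz μ)

/-- K ranges over [0, ∞], so the bound serves both a Carleson constant and every competitor in the
infimum defining `carlesonNorm`. -/
theorem exists_seqNorm_le_mul (m : ℕ) {α p q r : ℝ} (hα : 0 < α) (hq : 0 < q) (hqp : q < p)
    (hr : 0 < r) {z : ℕ → Cn n} (hz : IsHalfLattice r z) :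
    ∃ C : ℝ≥0∞, C ≠ ∞ ∧ ∀ (μ : Measure (Cn n)) (K : ℝ≥0∞),
      (∀ f : Cn n → ℂ, MemFockSobolev m α p f →
        carlesonIntegral α q μ f ≤ K * fockSobolevNorm m α p f ^ q) →
      seqNorm (p / (p - q)) (fun k => averaging (m * q) r μ (z k)) ≤ C * K := by
  obtain ⟨C, hC, h⟩ := exists_sum_averaging_le (n := n) m hα hq (hq.trans hqp) hr
  exact ⟨C, hC, fun μ K hK => seqNorm_le_of_sum_le hq hqp (h z hz μ K hK)⟩

theorem exists_seqNorm_le_carlesonNorm (m : ℕ) {α p q r : ℝ} (hα : 0 < α) (hq : 0 < q)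
    (hqp : q < p) (hr : 0 < r) {z : ℕ → Cn n} (hz : IsHalfLattice r z) :
    ∃ C : ℝ≥0, ∀ μ : Measure (Cn n),
      seqNorm (p / (p - q)) (fun k => averaging (m * q) r μ (z k)) ≤
        C * carlesonNorm m α p q μ ^ q := by
  obtain ⟨C, hC, h⟩ := exists_seqNorm_le_mul m hα hq hqp hr hz
  have hC1 : C + 1 ≠ ∞ := ENNReal.add_ne_top.2 ⟨hC, ENNReal.one_ne_top⟩
  have hC0 : C + 1 ≠ 0 := by simp
  refine exists_nnreal_mul_le hC1 fun μ => ?_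
  -- The bound is solved for the norm so that it can be checked against each element of the infimum;
  -- this division is why the constant must be nonzero.
  rw [← ENNReal.div_le_iff' hC0 hC1, ← ENNReal.rpow_inv_le_iff hq]
  refine le_sInf fun K hK => ?_
  rw [ENNReal.rpow_inv_le_iff hq, ENNReal.div_le_iff' hC0 hC1]
  exact (h μ _ hK).trans (by gcongr; exact le_self_add)

theorem exists_carlesonNorm_le_averaging (hn : 0 < n) (m : ℕ) {α p q r : ℝ} (hα : 0 < α)
    (hq : 0 < q) (hqp : q < p) (hr : 0 < r) :
    ∃ C : ℝ≥0, ∀ μ : Measure (Cn n), carlesonNorm m α p q μ ^ q ≤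
      C * eLpNorm (averaging (m * q) r μ) (ENNReal.ofReal (p / (p - q))) volume := by
  have hσ : 0 < p / (p - q) := (holderConjugate_div hq hqp).symm.pos
  obtain ⟨C, hC, h⟩ := exists_carlesonIntegral_le hn m hα hq hqp hr
  refine exists_nnreal_mul_le (ENNReal.add_ne_top.2 ⟨hC, ENNReal.one_ne_top⟩) fun μ => ?_
  rw [eLpNorm_ofReal hσ]
  by_cases hμ : ∫⁻ w, averaging (m * q) r μ w ^ (p / (p - q)) = ∞
  · rw [hμ, ENNReal.top_rpow_of_pos (by positivity), ENNReal.mul_top (by simp)]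
    exact le_top
  · rw [← ENNReal.le_rpow_inv_iff hq]
    refine sInf_le fun f hf => ?_
    rw [ENNReal.rpow_inv_rpow hq.ne']
    refine (h μ hμ f hf.1).trans ?_
    gcongr
    exact le_self_add

end FockSobolev

/-! ### The equivalences and the norm comparison. -/

open FockSobolev in
theorem mainTheorem2 (n : ℕ) (hn : 0 < n) (m : ℕ) (α : ℝ) (hα : 0 < α)
    (p q : ℝ) (hq : 0 < q) (hqp : q < p) :
    (∀ μ : Measure (FockSobolev.Cn n), List.TFAE [
      FockSobolev.IsFockCarleson m α p q μ,
      FockSobolev.IsVanishingFockCarleson m α p q μ,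
      ∃ t : ℝ, 0 < t ∧
        MemLp (FockSobolev.berezin α t (m * q) μ) (ENNReal.ofReal (p / (p - q))) volume,
      ∀ t : ℝ, 0 < t →
        MemLp (FockSobolev.berezin α t (m * q) μ) (ENNReal.ofReal (p / (p - q))) volume,
      ∃ r : ℝ, 0 < r ∧
        MemLp (FockSobolev.averaging (m * q) r μ) (ENNReal.ofReal (p / (p - q))) volume,
      ∀ r : ℝ, 0 < r →
        MemLp (FockSobolev.averaging (m * q) r μ) (ENNReal.ofReal (p / (p - q))) volume,
      ∃ r : ℝ, 0 < r ∧ ∃ z : ℕ → FockSobolev.Cn n, FockSobolev.IsHalfLattice r z ∧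
        FockSobolev.seqNorm (p / (p - q))
          (fun k => FockSobolev.averaging (m * q) r μ (z k)) < ∞,
      ∀ r : ℝ, 0 < r → ∀ z : ℕ → FockSobolev.Cn n, FockSobolev.IsHalfLattice r z →
        FockSobolev.seqNorm (p / (p - q))
          (fun k => FockSobolev.averaging (m * q) r μ (z k)) < ∞]) ∧
    (∀ t r : ℝ, 0 < t → 0 < r →
      ∀ z : ℕ → FockSobolev.Cn n, FockSobolev.IsHalfLattice r z →
      ∃ C : ℝ≥0, ∀ μ : Measure (FockSobolev.Cn n),
        FockSobolev.ComparableWith C (FockSobolev.carlesonNorm m α p q μ ^ q)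
          (eLpNorm (FockSobolev.averaging (m * q) r μ) (ENNReal.ofReal (p / (p - q))) volume) ∧
        FockSobolev.ComparableWith C
          (eLpNorm (FockSobolev.averaging (m * q) r μ) (ENNReal.ofReal (p / (p - q))) volume)
          (eLpNorm (FockSobolev.berezin α t (m * q) μ) (ENNReal.ofReal (p / (p - q))) volume) ∧
        FockSobolev.ComparableWith C
          (eLpNorm (FockSobolev.berezin α t (m * q) μ) (ENNReal.ofReal (p / (p - q))) volume)
          (FockSobolev.seqNorm (p / (p - q))
            (fun k => FockSobolev.averaging (m * q) r μ (z k)))) := by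
  have hp : 0 < p := hq.trans hqp
  have hσ : 1 < p / (p - q) := (holderConjugate_div hq hqp).symm.lt
  have hσ0 : 0 < p / (p - q) := one_pos.trans hσ
  have hs : 0 ≤ (m : ℝ) * q := by positivity
  refine ⟨fun μ => ?_, fun t r ht hr z hz => ?_⟩
  -- The implications form the cycle 1 → 8 → 7 → 5 → 2 → 1 together with the loop 5 → 4 → 3 → 6 → 5.
  · tfae_have 2 → 1 := fun h => h.isFockCarleson hn hα hp hq
    tfae_have 1 → 8 := by
      rintro ⟨K, hK⟩ r hr z hz
      obtain ⟨C, hC, h⟩ := exists_seqNorm_le_mul m hα hq hqp hr hz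
      exact (h μ K hK).trans_lt (ENNReal.mul_lt_top hC.lt_top ENNReal.coe_lt_top)
    tfae_have 8 → 7 := by
      intro h
      obtain ⟨z, hz⟩ := exists_isHalfLattice hn one_pos
      exact ⟨1, one_pos, z, hz, h 1 one_pos z hz⟩
    tfae_have 7 → 5 := by
      rintro ⟨r, hr, z, hz, h⟩
      obtain ⟨C, hC⟩ := exists_eLpNorm_averaging_le_seqNorm (r := r) hs hr hσ0 hz
      exact ⟨r, hr, (measurable_averaging _ _ _).aestronglyMeasurable,
        (hC μ).trans_lt (ENNReal.mul_lt_top ENNReal.coe_lt_top h)⟩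
    tfae_have 5 → 4 := by
      rintro ⟨r, hr, h⟩ t ht
      obtain ⟨C, hC⟩ := exists_eLpNorm_berezin_le (n := n) hα ht hs hr hσ
      exact ⟨(measurable_berezin hα ht hs _).aestronglyMeasurable,
        (hC μ).trans_lt (ENNReal.mul_lt_top ENNReal.coe_lt_top h.2)⟩
    tfae_have 4 → 3 := fun h => ⟨1, one_pos, h 1 one_pos⟩
    tfae_have 3 → 6 := by
      rintro ⟨t, ht, h⟩ r hr
      obtain ⟨C, hC⟩ := exists_eLpNorm_averaging_le_berezin (n := n) hα ht hs hr hσ0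
      exact ⟨(measurable_averaging _ _ _).aestronglyMeasurable,
        (hC μ).trans_lt (ENNReal.mul_lt_top ENNReal.coe_lt_top h.2)⟩
    tfae_have 6 → 5 := fun h => ⟨1, one_pos, h 1 one_pos⟩
    tfae_have 5 → 2 := by
      rintro ⟨r, hr, h⟩
      exact isVanishingFockCarleson_of_averaging hn m hα hq hqp hr
        ((eLpNorm_ofReal_lt_top_iff hσ0 _).1 h.2)
    tfae_finish
  · obtain ⟨c₁, h₁⟩ := exists_carlesonNorm_le_averaging hn m hα hq hqp hr
    obtain ⟨c₂, h₂⟩ := exists_eLpNorm_averaging_le_seqNorm (r := r) hs hr hσ0 hz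
    obtain ⟨c₃, h₃⟩ := exists_seqNorm_le_carlesonNorm m hα hq hqp hr hz
    obtain ⟨c₄, h₄⟩ := exists_eLpNorm_berezin_le (n := n) hα ht hs hr hσ
    obtain ⟨c₅, h₅⟩ := exists_eLpNorm_averaging_le_berezin (n := n) hα ht hs hr hσ0
    have trans' : ∀ {a b : ℝ≥0} {x y w : ℝ≥0∞}, x ≤ a * y → y ≤ b * w →
        x ≤ (a * b : ℝ≥0) * w := fun {a b x y w} hx hy => by
      rw [ENNReal.coe_mul, mul_assoc]
      exact hx.trans (by gcongr)
    have weaken : ∀ {a b : ℝ≥0} {x y : ℝ≥0∞}, a ≤ b → x ≤ a * y → x ≤ b * y :=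
      fun hab hx => hx.trans (by gcongr)
    -- The sum of the constants of the six composed inequalities dominates each of them.
    refine ⟨c₁ + c₂ * c₃ + c₄ + c₅ + c₄ * c₂ + c₃ * c₁ * c₅, fun μ =>
      ⟨⟨weaken ?_ (h₁ μ), weaken ?_ (trans' (h₂ μ) (h₃ μ))⟩,
        ⟨weaken ?_ (h₅ μ), weaken ?_ (h₄ μ)⟩,
        ⟨weaken ?_ (trans' (h₄ μ) (h₂ μ)),
          weaken ?_ (trans' (trans' (h₃ μ) (h₁ μ)) (h₅ μ))⟩⟩⟩
    all_goals
      rw [← NNReal.coe_le_coe]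
      push_cast
      have := mul_nonneg c₂.coe_nonneg c₃.coe_nonneg
      have := mul_nonneg c₄.coe_nonneg c₂.coe_nonneg
      have := mul_nonneg (mul_nonneg c₃.coe_nonneg c₁.coe_nonneg) c₅.coe_nonneg
      linarith [c₁.coe_nonneg, c₂.coe_nonneg, c₃.coe_nonneg, c₄.coe_nonneg, c₅.coe_nonneg]
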